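/- Let $A \subset D$ be a unital inclusion of unital C*-algebras with a faithful conditional expectation $E : D \to A$, and assume $A \neq 0$ has trivial center, $\mathcal Z(A) = \mathbb C 1$. A (right) $A$-$A$-correspondence is a right Hilbert $A$-module with a unital $*$-homomorphism from $A$ to its adjointable operators. Let $\mathcal E$ be the correspondence obtained by completing $D$ for $\langle x, y\rangle = E(x^*y)$, let $\mathrm{Hom}_{A-A}(K,L)$ be the space of adjointable $A$-$A$-bilinear maps, and $\mathrm{End}_{A-A}(K) = \mathrm{Hom}_{A-A}(K,K)$. Let $\mathsf{Bim}_{\mathsf{fgp}}(A)$ be the category of those correspondences that are finitely generated projective as right $A$-modules and bi-Hilbertian, i.e. that carry a left $A$-valued inner product, with the right action by adjointable operators, inducing the same topology. Let $\mathrm{Irr}(A)$ be a set of representatives of the isomorphism classes of $K \in \mathsf{Bim}_{\mathsf{fgp}}(A)$ with $\mathrm{End}_{A-A}(K) = \mathbb C$. For $K \in \mathrm{Irr}(A)$, $H_{\mathcal E}(K) := \mathrm{Hom}_{A-A}(K, \mathcal E)$ is a Hilbert space for $\langle f, g\rangle = f^*g \in \mathrm{End}_{A-A}(K) = \mathbb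 C$. For a family $H = (H(K))_{K \in \mathrm{Irr}(A)}$ of Hilbert spaces put $|H| := \bigoplus^{\ell^2}_{K \in \mathrm{Irr}(A)} K \otimes H(K)$; a correspondence belongs to $\mathsf{Hilb}(\mathsf{Bim}_{\mathsf{fgp}}(A))$ if it is unitarily isomorphic to some $|H|$. The inclusion is called an ind-inclusion if $\mathcal E \cong |H_{\mathcal E}|$ as correspondences. The following are equivalent. (i) $A \subset D$ (with $E$) is an ind-inclusion. (ii) There is a family $(P_i)_{i \in I}$ of mutually orthogonal central projections in $\mathrm{End}_{A-A}(\mathcal E)$ such that: (1) $\sum_i P_i$ converges strictly to $\mathrm{id}_{\mathcal E}$; (2) for each $i$ there is a Hilbert space $H_i$ (possibly zero) with $P_i\,\mathrm{End}_{A-A}(\mathcal E) \cong \mathcal B(H_i)$ as $*$-algebras; (3) for every projection $P \in \mathrm{End}_{A-A}(\mathcal E)$, $P(\mathcal E)$ belongs to $\mathsf{Hilb}(\mathsf{Bim}_{\mathsf{fgp}}(A))$. Moreover, if $A \subset D$ is an ind-inclusion, then $\mathrm{End}_{A-A}(\mathcal E) \cong \prod^{\ell^\infty}_{K \in \mathrm{Irr}(A)}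 \mathcal B(H_{\mathcal E}(K))$ as $*$-algebras. -/

import Mathlib

universe u v w z

namespace CStarCorr

noncomputable section

open scoped TensorProduct ComplexOrder ENNReal

/-- An `A`-`A`-bimodule with an `A`-valued right (semi-definite) inner product, linear in the second
variable, for which the left action is by `⋆`-adjointable operators. The right action is a module
structure over `Aᵐᵒᵖ`: `x ◁ a` is `MulOpposite.op a • x`. (Mathlib's `CStarModule` is the notion for
left modules.) -/
structure PreCorr (A : Type u) [CStarAlgebra A] [PartialOrder A] [StarOrderedRing A] where
  carrier : Type v
  [addCommGroup : AddCommGroup carrier]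
  [module : Module ℂ carrier]
  [leftModule : Module A carrier]
  [rightModule : Module Aᵐᵒᵖ carrier]
  [leftTower : IsScalarTower ℂ A carrier]
  [rightTower : IsScalarTower ℂ Aᵐᵒᵖ carrier]
  [bimodule : SMulCommClass A Aᵐᵒᵖ carrier]
  ip : carrier → carrier → A
  ip_add_right : ∀ x y z, ip x (y + z) = ip x y + ip x z
  ip_smul_right : ∀ (c : ℂ) x y, ip x (c • y) = c • ip x y
  ip_op_smul_right : ∀ (a : A) x y, ip x (MulOpposite.op a • y) = ip x y * a
  star_ip : ∀ x y, star (ip x y) = ip y x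
  ip_self_nonneg : ∀ x, 0 ≤ ip x x
  ip_left_smul : ∀ (a : A) x y, ip (a • x) y = ip x (star a • y)

attribute [instance] PreCorr.addCommGroup PreCorr.module PreCorr.leftModule PreCorr.rightModule
  PreCorr.leftTower PreCorr.rightTower PreCorr.bimodule

variable {A : Type u} [CStarAlgebra A] [PartialOrder A] [StarOrderedRing A]

namespace PreCorr

instance : CoeSort (PreCorr.{u, v} A) (Type v) := ⟨PreCorr.carrier⟩

variable (V : PreCorr.{u, v} A)

/-- The inner product as a sesquilinear map. -/
def ipₛₗ : V →ₗ⋆[ℂ] V →ₗ[ℂ] A where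
  toFun x :=
    { toFun := V.ip x
      map_add' := V.ip_add_right x
      map_smul' := fun c y => V.ip_smul_right c x y }
  map_add' x y := by
    ext z
    change V.ip (x + y) z = V.ip x z + V.ip y z
    rw [← V.star_ip, V.ip_add_right, star_add, V.star_ip, V.star_ip]
  map_smul' c x := by
    ext z
    change V.ip (c • x) z = star c • V.ip x z
    rw [← V.star_ip, V.ip_smul_right, star_smul, V.star_ip]

theorem ipₛₗ_apply (x y : V) : V.ipₛₗ x y = V.ip x y := rfl

theorem ip_add_left (x y z : V) : V.ip (x + y) z = V.ip x z + V.ip y z := by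
  simp only [← ipₛₗ_apply, map_add, LinearMap.add_apply]

theorem ip_smul_left (c : ℂ) (x y : V) : V.ip (c • x) y = star c • V.ip x y := by
  simp only [← ipₛₗ_apply, map_smulₛₗ, LinearMap.smul_apply]; rfl

theorem ip_sub_left (x y z : V) : V.ip (x - y) z = V.ip x z - V.ip y z := by
  simp only [← ipₛₗ_apply, map_sub, LinearMap.sub_apply]

theorem ip_sub_right (x y z : V) : V.ip x (y - z) = V.ip x y - V.ip x z := by
  simp only [← ipₛₗ_apply, map_sub]

theorem ip_op_smul_left (a : A) (x y : V) :
    V.ip (MulOpposite.op a • x) y = star a * V.ip x y := by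
  rw [← V.star_ip, V.ip_op_smul_right, star_mul, V.star_ip]

/-- The (semi-)norm `‖x‖ = ‖⟨x, x⟩‖ ^ (1/2)`. -/
instance : Norm V := ⟨fun x => √‖V.ip x x‖⟩

theorem norm_def (x : V) : ‖x‖ = √‖V.ip x x‖ := rfl

theorem norm_sq (x : V) : ‖x‖ ^ 2 = ‖V.ip x x‖ := by
  rw [norm_def, Real.sq_sqrt (norm_nonneg _)]

theorem ip_mul_ip_le (x y : V) {t : ℝ} (ht : 0 < t) (hx : ‖V.ip x x‖ ≤ t) :
    V.ip y x * V.ip x y ≤ t • V.ip y y := by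
  have hsm : ∀ (r : ℝ) (z w : V), V.ip z (((r : ℂ)) • w) = r • V.ip z w := fun r z w => by
    rw [V.ip_smul_right]; simp
  have hsm' : ∀ (r : ℝ) (z w : V), V.ip (((r : ℂ)) • z) w = r • V.ip z w := fun r z w => by
    rw [V.ip_smul_left]; simp
  set a := V.ip x y with ha
  have hya : V.ip y x = star a := (V.star_ip x y).symm
  have h0 := V.ip_self_nonneg (MulOpposite.op a • x - (t : ℂ) • y)
  have h1 : V.ip (MulOpposite.op a • x - (t : ℂ) • y) (MulOpposite.op a • x - (t : ℂ) • y)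
      = star a * V.ip x x * a - (2 * t) • (star a * a) + t • (t • V.ip y y) := by
    simp only [ip_sub_left, ip_sub_right, hsm, hsm', ip_op_smul_left, ip_op_smul_right, ← ha, hya,
      sub_mul, smul_sub, smul_mul_assoc, mul_assoc, two_mul, add_smul]
    abel
  have h2 : star a * V.ip x x * a ≤ t • (star a * a) := by
    calc _ ≤ ‖V.ip x x‖ • (star a * a) :=
          CStarAlgebra.star_left_conjugate_le_norm_smul (hb := IsSelfAdjoint.of_nonneg (V.ip_self_nonneg x))
      _ ≤ _ := by
          have := star_mul_self_nonneg a
          gcongr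
  rw [h1] at h0
  have h3 : (0 : A) ≤ t • (t • V.ip y y - star a * a) := by
    calc (0 : A) ≤ _ := h0
      _ ≤ t • (star a * a) - (2 * t) • (star a * a) + t • (t • V.ip y y) := by gcongr
      _ = _ := by rw [smul_sub, two_mul, add_smul]; abel
  have h4 : t • (star a * a) ≤ t • (t • V.ip y y) := by
    rwa [smul_sub, sub_nonneg] at h3
  rw [hya]
  exact (smul_le_smul_iff_of_pos_left ht).1 h4

theorem norm_ip_le (x y : V) : ‖V.ip x y‖ ≤ ‖x‖ * ‖y‖ := by
  have key : ∀ t : ℝ, ‖V.ip x x‖ < t → ‖V.ip x y‖ ^ 2 ≤ t * ‖V.ip y y‖ := by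
    intro t ht
    have ht0 : 0 < t := (norm_nonneg _).trans_lt ht
    have h := V.ip_mul_ip_le x y ht0 ht.le
    rw [← V.star_ip x y] at h
    have h' := CStarAlgebra.norm_le_norm_of_nonneg_of_le (star_mul_self_nonneg _) h
    rw [CStarRing.norm_star_mul_self, norm_smul, Real.norm_of_nonneg ht0.le] at h'
    rwa [sq]
  have h2 : ‖V.ip x y‖ ^ 2 ≤ ‖V.ip x x‖ * ‖V.ip y y‖ := by
    refine le_of_forall_pos_le_add fun ε hε => ?_
    have h := key (‖V.ip x x‖ + ε / (‖V.ip y y‖ + 1)) (lt_add_of_pos_right _ (by positivity))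
    refine h.trans ?_
    rw [add_mul]
    gcongr
    rw [div_mul_eq_mul_div, div_le_iff₀ (by positivity)]
    nlinarith [norm_nonneg (V.ip y y)]
  rw [norm_def, norm_def, ← Real.sqrt_mul (norm_nonneg _)]
  exact Real.le_sqrt_of_sq_le h2

theorem seminormedCore : SeminormedSpace.Core ℂ V where
  norm_nonneg _ := Real.sqrt_nonneg _
  norm_smul c x := by
    rw [norm_def, norm_def, V.ip_smul_left, V.ip_smul_right, norm_smul, norm_smul, norm_star,
      ← mul_assoc, Real.sqrt_mul (by positivity), Real.sqrt_mul_self (norm_nonneg _)]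
  norm_triangle x y := by
    have hn : ∀ z : V, 0 ≤ ‖z‖ := fun z => Real.sqrt_nonneg _
    refine (pow_le_pow_iff_left₀ (hn _) (add_nonneg (hn _) (hn _)) two_ne_zero).1 ?_
    rw [norm_sq, V.ip_add_left, V.ip_add_right, V.ip_add_right]
    calc _ ≤ (‖V.ip x x‖ + ‖V.ip x y‖) + (‖V.ip y x‖ + ‖V.ip y y‖) :=
          (norm_add_le _ _).trans (add_le_add (norm_add_le _ _) (norm_add_le _ _))
      _ ≤ (‖x‖ ^ 2 + ‖x‖ * ‖y‖) + (‖y‖ * ‖x‖ + ‖y‖ ^ 2) := by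
          rw [norm_sq, norm_sq]
          gcongr <;> exact V.norm_ip_le _ _
      _ = _ := by ring

instance : SeminormedAddCommGroup V := SeminormedAddCommGroup.ofCore V.seminormedCore

instance : NormedSpace ℂ V := ⟨fun c x => (V.seminormedCore.norm_smul c x).le⟩

theorem norm_op_smul_le (a : A) (x : V) : ‖MulOpposite.op a • x‖ ≤ ‖a‖ * ‖x‖ := by
  refine (pow_le_pow_iff_left₀ (norm_nonneg _) (by positivity) two_ne_zero).1 ?_
  rw [norm_sq, mul_pow, norm_sq, V.ip_op_smul_left, V.ip_op_smul_right]
  calc _ ≤ ‖star a‖ * (‖V.ip x x‖ * ‖a‖) :=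
        (norm_mul_le _ _).trans (by gcongr; exact norm_mul_le _ _)
    _ = _ := by rw [norm_star]; ring

theorem norm_left_smul_le (a : A) (x : V) : ‖a • x‖ ≤ ‖a‖ * ‖x‖ := by
  refine (pow_le_pow_iff_left₀ (norm_nonneg _) (by positivity) two_ne_zero).1 ?_
  have h1 : star a * a ≤ algebraMap ℝ A (‖a‖ ^ 2) := by
    have := CStarAlgebra.star_mul_le_algebraMap_norm_sq (a := a)
    exact this
  obtain ⟨b, hb⟩ := (CStarAlgebra.nonneg_iff_eq_star_mul_self).1 (sub_nonneg.2 h1)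
  have h2 : (0 : A) ≤ (‖a‖ ^ 2) • V.ip x x - V.ip (a • x) (a • x) := by
    have h3 : V.ip (b • x) (b • x) = (‖a‖ ^ 2) • V.ip x x - V.ip (a • x) (a • x) := by
      rw [V.ip_left_smul, V.ip_left_smul, smul_smul, smul_smul, ← hb, sub_smul, ip_sub_right]
      congr 1
      have : (algebraMap ℝ A (‖a‖ ^ 2)) • x = ((‖a‖ ^ 2 : ℝ) : ℂ) • x := by
        rw [← algebraMap_smul A ((‖a‖ ^ 2 : ℝ) : ℂ) x]
        rfl
      rw [this, V.ip_smul_right]; exact Complex.coe_smul _ _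
    rw [← h3]; exact V.ip_self_nonneg _
  have h4 := CStarAlgebra.norm_le_norm_of_nonneg_of_le (V.ip_self_nonneg (a • x)) (sub_nonneg.1 h2)
  rw [norm_smul, Real.norm_of_nonneg (by positivity)] at h4
  rwa [norm_sq, mul_pow, norm_sq]

instance : UniformContinuousConstSMul A V :=
  ⟨fun a => (AddMonoidHomClass.uniformContinuous_of_bound (DistribSMul.toAddMonoidHom V a) ‖a‖
    (fun x => V.norm_left_smul_le a x))⟩

instance : UniformContinuousConstSMul Aᵐᵒᵖ V :=
  ⟨fun a => (AddMonoidHomClass.uniformContinuous_of_bound (DistribSMul.toAddMonoidHom V a)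
    ‖a.unop‖ (fun x => V.norm_op_smul_le a.unop x))⟩

theorem continuous_ip : Continuous fun p : V × V => V.ip p.1 p.2 := by
  let f : V →L⋆[ℂ] V →L[ℂ] A := LinearMap.mkContinuous₂ V.ipₛₗ 1 fun x y => by
    simpa [ipₛₗ_apply] using V.norm_ip_le x y
  have : ∀ p : V × V, V.ip p.1 p.2 = f p.1 p.2 := fun p => rfl
  simp_rw [this]
  fun_prop

open UniformSpace

/-- The inner product extended by continuity to the (separated) completion. -/
def completionIp (x y : Completion V) : A :=
  (Completion.isDenseInducing_coe.prodMap Completion.isDenseInducing_coe).extend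
    (fun p : V × V => V.ip p.1 p.2) (x, y)

theorem completionIp_coe (x y : V) : V.completionIp (x : Completion V) (y : Completion V) = V.ip x y :=
  (Completion.isDenseInducing_coe.prodMap Completion.isDenseInducing_coe).extend_eq
    V.continuous_ip (x, y)

theorem continuous_completionIp :
    Continuous fun p : Completion V × Completion V => V.completionIp p.1 p.2 := by
  let ip' : V →+ V →+ A :=
    { toFun := fun x => (V.ipₛₗ x).toAddMonoidHom
      map_zero' := by ext x; simp
      map_add' := fun x y => by ext z; simp }
  have : Continuous fun p : V × V => ip' p.1 p.2 := V.continuous_ip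
  exact (Completion.isDenseInducing_toCompl V).extend_Z_bilin
    (Completion.isDenseInducing_toCompl V) this

theorem continuous_completionIp_comp {X : Type*} [TopologicalSpace X] {f g : X → Completion V}
    (hf : Continuous f) (hg : Continuous g) : Continuous fun x => V.completionIp (f x) (g x) :=
  V.continuous_completionIp.comp (hf.prodMk hg)

theorem completionIp_add_right (x y z : Completion V) :
    V.completionIp x (y + z) = V.completionIp x y + V.completionIp x z := by
  refine Completion.induction_on₃ x y z (isClosed_eq
    (V.continuous_completionIp_comp continuous_fst
      ((continuous_fst.comp continuous_snd).add (continuous_snd.comp continuous_snd)))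
    ((V.continuous_completionIp_comp continuous_fst (continuous_fst.comp continuous_snd)).add
      (V.continuous_completionIp_comp continuous_fst (continuous_snd.comp continuous_snd))))
    fun a b c => ?_
  rw [← Completion.coe_add, completionIp_coe, completionIp_coe, completionIp_coe, V.ip_add_right]

theorem completionIp_smul_right (c : ℂ) (x y : Completion V) :
    V.completionIp x (c • y) = c • V.completionIp x y := by
  refine Completion.induction_on₂ x y (isClosed_eq
    (V.continuous_completionIp_comp continuous_fst (continuous_snd.const_smul c))
    ((V.continuous_completionIp_comp continuous_fst continuous_snd).const_smul c)) fun a b => ?_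
  rw [← Completion.coe_smul, completionIp_coe, completionIp_coe, V.ip_smul_right]

theorem completionIp_op_smul_right (c : A) (x y : Completion V) :
    V.completionIp x (MulOpposite.op c • y) = V.completionIp x y * c := by
  refine Completion.induction_on₂ x y (isClosed_eq
    (V.continuous_completionIp_comp continuous_fst (continuous_snd.const_smul (MulOpposite.op c)))
    ((V.continuous_completionIp_comp continuous_fst continuous_snd).mul continuous_const))
    fun a b => ?_
  rw [← Completion.coe_smul, completionIp_coe, completionIp_coe, V.ip_op_smul_right]

theorem star_completionIp (x y : Completion V) :
    star (V.completionIp x y) = V.completionIp y x := by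
  refine Completion.induction_on₂ x y (isClosed_eq
    (V.continuous_completionIp_comp continuous_fst continuous_snd).star
    (V.continuous_completionIp_comp continuous_snd continuous_fst)) fun a b => ?_
  rw [completionIp_coe, completionIp_coe, V.star_ip]

theorem completionIp_self_nonneg (x : Completion V) : 0 ≤ V.completionIp x x := by
  refine Completion.induction_on x (isClosed_le continuous_const
    (V.continuous_completionIp_comp continuous_id continuous_id)) fun a => ?_
  rw [completionIp_coe]
  exact V.ip_self_nonneg a

theorem completionIp_left_smul (c : A) (x y : Completion V) :
    V.completionIp (c • x) y = V.completionIp x (star c • y) := by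
  refine Completion.induction_on₂ x y (isClosed_eq
    (V.continuous_completionIp_comp (continuous_fst.const_smul c) continuous_snd)
    (V.continuous_completionIp_comp continuous_fst (continuous_snd.const_smul (star c))))
    fun a b => ?_
  rw [← Completion.coe_smul, ← Completion.coe_smul, completionIp_coe, completionIp_coe,
    V.ip_left_smul]

/-- The (separated) completion of `V`, with all operations extended by continuity. -/
def completionPre : PreCorr.{u, v} A where
  carrier := Completion V
  ip := V.completionIp
  ip_add_right := V.completionIp_add_right
  ip_smul_right := V.completionIp_smul_right
  ip_op_smul_right := V.completionIp_op_smul_right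
  star_ip := V.star_completionIp
  ip_self_nonneg := V.completionIp_self_nonneg
  ip_left_smul := V.completionIp_left_smul

theorem completion_norm (x : Completion V) : ‖x‖ = √‖V.completionIp x x‖ := by
  refine Completion.induction_on x (isClosed_eq continuous_norm
    (V.continuous_completionIp_comp continuous_id continuous_id).norm.sqrt) fun a => ?_
  rw [completionIp_coe, Completion.norm_coe, norm_def]

/-- The norm given by the inner product is the norm of the completion. -/
def completionEquiv : Completion V ≃ᵢ V.completionPre where
  toEquiv := Equiv.refl _
  isometry_toFun := by
    let φ : Completion V →+ V.completionPre :=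
      { toFun := fun x => x
        map_zero' := rfl
        map_add' := fun _ _ => rfl }
    exact AddMonoidHomClass.isometry_of_norm φ fun x => (V.completion_norm x).symm

end PreCorr

/-- `V` is complete for the norm `‖x‖ = ‖⟨x, x⟩‖ ^ (1/2)`. -/
def PreCorr.IsComplete (V : PreCorr.{u, v} A) : Prop := CompleteSpace V

/-- A right `A`-`A`-correspondence: a right Hilbert `A`-module, with a unital `⋆`-homomorphism from
`A` to its adjointable operators. Since `A` and the action are unital, it is non-degenerate. -/
structure Corr (A : Type u) [CStarAlgebra A] [PartialOrder A] [StarOrderedRing A] extends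
    PreCorr.{u, v} A where
  definite : ∀ x, ip x x = 0 → x = 0
  complete : toPreCorr.IsComplete

/-- The correspondence obtained from `V` by separation and completion. -/
def PreCorr.completion (V : PreCorr.{u, v} A) : Corr.{u, v} A where
  toPreCorr := V.completionPre
  definite x hx := by
    have h := V.completion_norm x
    have hx' : V.completionIp x x = 0 := hx
    rw [hx', norm_zero, Real.sqrt_zero] at h
    exact norm_eq_zero.1 h
  complete := V.completionEquiv.symm.completeSpace

namespace Corr

instance : CoeSort (Corr.{u, v} A) (Type v) := ⟨fun K => K.carrier⟩

instance (K : Corr.{u, v} A) : CompleteSpace K := K.complete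

variable {K : Corr.{u, v} A} {L : Corr.{u, w} A}

theorem norm_eq_zero_iff {x : K} : ‖x‖ = 0 ↔ x = 0 := by
  refine ⟨fun h => K.definite x ?_, fun h => by rw [h, norm_zero]⟩
  rwa [← norm_eq_zero, ← PreCorr.norm_sq, sq_eq_zero_iff]

instance : NormedAddCommGroup K :=
  NormedAddCommGroup.ofSeparation fun _ h => norm_eq_zero_iff.1 h

theorem ext_ip {x y : K} (h : ∀ z, K.ip z x = K.ip z y) : x = y := by
  rw [← sub_eq_zero]
  refine K.definite _ ?_
  rw [PreCorr.ip_sub_right, sub_eq_zero]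
  exact h _

/-- `f` is an `A`-`A`-bilinear map admitting an adjoint. -/
def IsMorphism (f : K →ₗ[ℂ] L) : Prop :=
  (∀ (a : A) x, f (a • x) = a • f x) ∧
  (∀ (a : A) x, f (MulOpposite.op a • x) = MulOpposite.op a • f x) ∧
  ∃ g : L → K, ∀ x y, L.ip (f x) y = K.ip x (g y)

end Corr

namespace Corr

variable (K : Corr.{u, v} A) (L : Corr.{u, w} A)

/-- The space of adjointable `A`-`A`-bilinear maps from `K` to `L`. -/
def homSpace : Submodule ℂ (K →ₗ[ℂ] L) where
  carrier := {f | IsMorphism f}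
  add_mem' := by
    rintro f g ⟨hf, hf', f', hff⟩ ⟨hg, hg', g', hgg⟩
    refine ⟨fun a x => ?_, fun a x => ?_, fun y => f' y + g' y, fun x y => ?_⟩
    · rw [LinearMap.add_apply, LinearMap.add_apply, hf, hg, smul_add]
    · rw [LinearMap.add_apply, LinearMap.add_apply, hf', hg', smul_add]
    · rw [LinearMap.add_apply, PreCorr.ip_add_left, hff, hgg, PreCorr.ip_add_right]
  zero_mem' := by
    refine ⟨fun a x => ?_, fun a x => ?_, fun y => 0, fun x y => ?_⟩
    · simp
    · simp
    · simp [← PreCorr.ipₛₗ_apply]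
  smul_mem' := by
    rintro c f ⟨hf, hf', f', hff⟩
    refine ⟨fun a x => ?_, fun a x => ?_, fun y => star c • f' y, fun x y => ?_⟩
    · rw [LinearMap.smul_apply, LinearMap.smul_apply, hf, smul_comm]
    · rw [LinearMap.smul_apply, LinearMap.smul_apply, hf', smul_comm]
    · rw [LinearMap.smul_apply, PreCorr.ip_smul_left, hff, PreCorr.ip_smul_right]

/-- The algebra of adjointable `A`-`A`-bilinear endomorphisms of `K`. -/
def endAlg : Subalgebra ℂ (Module.End ℂ K) where
  carrier := {f | IsMorphism f}
  add_mem' := (homSpace K K).add_mem'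
  mul_mem' := by
    rintro f g ⟨hf, hf', f', hff⟩ ⟨hg, hg', g', hgg⟩
    refine ⟨fun a x => ?_, fun a x => ?_, fun y => g' (f' y), fun x y => ?_⟩
    · rw [Module.End.mul_apply, Module.End.mul_apply, hg, hf]
    · rw [Module.End.mul_apply, Module.End.mul_apply, hg', hf']
    · rw [Module.End.mul_apply, hff, hgg]
  algebraMap_mem' c := by
    refine ⟨fun a x => ?_, fun a x => ?_, fun y => star c • y, fun x y => ?_⟩
    · simp only [Module.algebraMap_end_apply]; rw [smul_comm]
    · simp only [Module.algebraMap_end_apply]; rw [smul_comm]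
    · rw [Module.algebraMap_end_apply, PreCorr.ip_smul_left, PreCorr.ip_smul_right]

variable {K L}

theorem exists_adj (f : homSpace K L) : ∃ g : L → K, ∀ x y, L.ip (f.1 x) y = K.ip x (g y) :=
  f.2.2.2

/-- The adjoint of a morphism, as a function. -/
def adjFun (f : homSpace K L) : L → K := (exists_adj f).choose

theorem ip_adjFun (f : homSpace K L) (x : K) (y : L) :
    K.ip x (adjFun f y) = L.ip (f.1 x) y :=
  ((exists_adj f).choose_spec x y).symm

/-- The adjoint of a morphism. -/
def adj (f : homSpace K L) : homSpace L K :=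
  ⟨{  toFun := adjFun f
      map_add' := fun x y => ext_ip fun z => by
        rw [ip_adjFun, PreCorr.ip_add_right, PreCorr.ip_add_right, ip_adjFun, ip_adjFun]
      map_smul' := fun c x => ext_ip fun z => by
        rw [ip_adjFun, PreCorr.ip_smul_right, RingHom.id_apply, PreCorr.ip_smul_right,
          ip_adjFun] },
    fun a x => ext_ip fun z => by
      change K.ip z (adjFun f (a • x)) = K.ip z (a • adjFun f x)
      have h := K.ip_left_smul (star a) z (adjFun f x)
      have h' := L.ip_left_smul (star a) (f.1 z) x
      rw [star_star] at h h'
      rw [ip_adjFun, ← h', ← h, ← f.2.1, ip_adjFun],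
    fun a x => ext_ip fun z => by
      change K.ip z (adjFun f (MulOpposite.op a • x)) = K.ip z (MulOpposite.op a • adjFun f x)
      rw [ip_adjFun, PreCorr.ip_op_smul_right, PreCorr.ip_op_smul_right, ip_adjFun],
    f.1, fun x y => by
      change K.ip (adjFun f x) y = L.ip x (f.1 y)
      rw [← PreCorr.star_ip, ip_adjFun, PreCorr.star_ip]⟩

theorem ip_adj_right (f : homSpace K L) (x : K) (y : L) :
    K.ip x ((adj f).1 y) = L.ip (f.1 x) y :=
  ip_adjFun f x y

theorem adj_eq {f : homSpace K L} {g : homSpace L K}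
    (h : ∀ x y, L.ip (f.1 x) y = K.ip x (g.1 y)) : adj f = g := by
  refine Subtype.ext (LinearMap.ext fun y => ext_ip fun x => ?_)
  rw [ip_adj_right, h]

theorem ip_adj_left (f : homSpace K L) (x : L) (y : K) :
    K.ip ((adj f).1 x) y = L.ip x (f.1 y) := by
  rw [← PreCorr.star_ip, ip_adj_right, PreCorr.star_ip]

instance : StarRing (endAlg K) where
  star f := ⟨(adj (⟨f.1, f.2⟩ : homSpace K K)).1, (adj (⟨f.1, f.2⟩ : homSpace K K)).2⟩
  star_involutive f := Subtype.ext <| LinearMap.ext fun y => ext_ip fun x => by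
    exact (ip_adj_right (adj (⟨f.1, f.2⟩ : homSpace K K)) x y).trans
      (ip_adj_left (⟨f.1, f.2⟩ : homSpace K K) x y)
  star_mul f g := Subtype.ext <| LinearMap.ext fun y => ext_ip fun x => by
    refine (ip_adj_right (⟨(f * g).1, (f * g).2⟩ : homSpace K K) x y).trans ?_
    refine Eq.trans ?_ (ip_adj_right (⟨g.1, g.2⟩ : homSpace K K) x _).symm
    exact (ip_adj_right (⟨f.1, f.2⟩ : homSpace K K) (g.1 x) y).symm
  star_add f g := Subtype.ext <| LinearMap.ext fun y => ext_ip fun x => by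
    refine (ip_adj_right (⟨(f + g).1, (f + g).2⟩ : homSpace K K) x y).trans ?_
    refine (PreCorr.ip_add_left _ _ _ _).trans ?_
    refine Eq.trans ?_ (PreCorr.ip_add_right _ _ _ _).symm
    exact congrArg₂ _ (ip_adj_right (⟨f.1, f.2⟩ : homSpace K K) x y).symm
      (ip_adj_right (⟨g.1, g.2⟩ : homSpace K K) x y).symm

theorem ip_star_right (f : endAlg K) (x y : K) : K.ip x ((star f).1 y) = K.ip (f.1 x) y :=
  ip_adj_right (⟨f.1, f.2⟩ : homSpace K K) x y

instance : StarModule ℂ (endAlg K) where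
  star_smul c f := Subtype.ext <| LinearMap.ext fun y => ext_ip fun x => by
    refine (ip_star_right (c • f) x y).trans ?_
    refine (PreCorr.ip_smul_left _ _ _ _).trans ?_
    refine Eq.trans ?_ (PreCorr.ip_smul_right _ _ _ _).symm
    exact congrArg _ (ip_star_right f x y).symm

/-- Strict convergence of the net of finite partial sums of `∑ i, P i` to `T`: pointwise norm
convergence of the operators and of their adjoints. -/
def StrictHasSum {ι : Type*} (P : ι → endAlg K) (T : endAlg K) : Prop :=
  (∀ x : K, HasSum (fun i => (P i).1 x) (T.1 x)) ∧
  (∀ x : K, HasSum (fun i => (star (P i)).1 x) ((star T).1 x))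

/-- The corner `P · End_{A-A}(K) · P`, a `⋆`-algebra with unit `P`. If `P` is central, it is
`P · End_{A-A}(K)`. -/
def corner (P : endAlg K) (hP : IsStarProjection P) : NonUnitalStarSubalgebra ℂ (endAlg K) where
  carrier := {T | P * T = T ∧ T * P = T}
  add_mem' := by
    rintro S T ⟨hS, hS'⟩ ⟨hT, hT'⟩
    exact ⟨by rw [mul_add, hS, hT], by rw [add_mul, hS', hT']⟩
  zero_mem' := ⟨mul_zero _, zero_mul _⟩
  mul_mem' := by
    rintro S T ⟨hS, hS'⟩ ⟨hT, hT'⟩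
    exact ⟨by rw [← mul_assoc, hS], by rw [mul_assoc, hT']⟩
  smul_mem' := by
    rintro c T ⟨hT, hT'⟩
    exact ⟨by rw [mul_smul_comm, hT], by rw [smul_mul_assoc, hT']⟩
  star_mem' := by
    rintro T ⟨hT, hT'⟩
    have h : star P = P := hP.isSelfAdjoint
    refine ⟨?_, ?_⟩
    · have := congrArg star hT'
      rwa [star_mul, h] at this
    · have := congrArg star hT
      rwa [star_mul, h] at this

section range

variable (P : endAlg K)

instance : Module A (LinearMap.range P.1) where
  smul a x := ⟨a • x.1, by obtain ⟨y, hy⟩ := x.2; exact ⟨a • y, by rw [P.2.1, hy]⟩⟩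
  one_smul x := Subtype.ext (one_smul A x.1)
  mul_smul a b x := Subtype.ext (mul_smul a b x.1)
  smul_zero a := Subtype.ext (smul_zero a)
  smul_add a x y := Subtype.ext (smul_add a x.1 y.1)
  add_smul a b x := Subtype.ext (add_smul a b x.1)
  zero_smul x := Subtype.ext (zero_smul A x.1)

instance : Module Aᵐᵒᵖ (LinearMap.range P.1) where
  smul a x := ⟨a • x.1, by
    obtain ⟨y, hy⟩ := x.2
    exact ⟨a • y, by rw [← MulOpposite.op_unop a, P.2.2.1, hy]⟩⟩
  one_smul x := Subtype.ext (one_smul Aᵐᵒᵖ x.1)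
  mul_smul a b x := Subtype.ext (mul_smul a b x.1)
  smul_zero a := Subtype.ext (smul_zero a)
  smul_add a x y := Subtype.ext (smul_add a x.1 y.1)
  add_smul a b x := Subtype.ext (add_smul a b x.1)
  zero_smul x := Subtype.ext (zero_smul Aᵐᵒᵖ x.1)

/-- The range of an endomorphism, with the structure inherited from `K`. -/
def rangePre : PreCorr.{u, v} A where
  carrier := LinearMap.range P.1
  leftTower := ⟨fun c a x => Subtype.ext (smul_assoc c a x.1)⟩
  rightTower := ⟨fun c a x => Subtype.ext (smul_assoc c a x.1)⟩
  bimodule := ⟨fun a b x => Subtype.ext (smul_comm a b x.1)⟩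
  ip x y := K.ip x.1 y.1
  ip_add_right _ _ _ := PreCorr.ip_add_right _ _ _ _
  ip_smul_right _ _ _ := PreCorr.ip_smul_right _ _ _ _
  ip_op_smul_right _ _ _ := PreCorr.ip_op_smul_right _ _ _ _
  star_ip _ _ := PreCorr.star_ip _ _ _
  ip_self_nonneg _ := PreCorr.ip_self_nonneg _ _
  ip_left_smul _ _ _ := PreCorr.ip_left_smul _ _ _ _

variable {P}

theorem norm_projection_le (hP : IsStarProjection P) (x : K) : ‖P.1 x‖ ≤ ‖x‖ := by
  have h1 : ‖P.1 x‖ ^ 2 ≤ ‖x‖ * ‖P.1 x‖ := by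
    have h : K.ip (P.1 x) (P.1 x) = K.ip x (P.1 x) := by
      have h2 : star P = P := hP.isSelfAdjoint
      have h3 : P.1 (P.1 x) = P.1 x := by
        have := congrArg (fun Q : endAlg K => Q.1 x) hP.isIdempotentElem
        exact this
      rw [← ip_star_right, h2, h3]
    rw [PreCorr.norm_sq, show K.toPreCorr.ip (P.1 x) (P.1 x) = K.toPreCorr.ip x (P.1 x) from h]
    exact PreCorr.norm_ip_le _ _ _
  by_contra! hlt
  nlinarith [norm_nonneg x]

/-- The range of a projection in `End_{A-A}(K)`, as a subcorrespondence of `K`. -/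
def range (P : endAlg K) (hP : IsStarProjection P) : Corr.{u, v} A where
  toPreCorr := rangePre P
  definite x hx := Subtype.ext (K.definite _ hx)
  complete := by
    let φ : rangePre P →+ K :=
      { toFun := fun x => Subtype.val (p := fun y => y ∈ LinearMap.range P.1) x
        map_zero' := rfl
        map_add' := fun _ _ => rfl }
    have hφ : Isometry φ := AddMonoidHomClass.isometry_of_norm φ fun x => rfl
    change CompleteSpace (rangePre P)
    rw [completeSpace_iff_isComplete_range hφ.isUniformInducing]
    have hcont : Continuous P.1 :=
      AddMonoidHomClass.continuous_of_bound P.1 1 fun x => by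
        rw [one_mul]; exact norm_projection_le hP x
    have hset : Set.range φ = {x | P.1 x = x} := by
      ext x
      constructor
      · rintro ⟨⟨y, z, rfl⟩, rfl⟩
        exact congrArg (fun Q : endAlg K => Q.1 z) hP.isIdempotentElem
      · intro hx
        exact ⟨⟨x, x, hx⟩, rfl⟩
    rw [hset]
    exact (isClosed_eq hcont continuous_id).isComplete

end range

variable (K L)

/-- Unitary isomorphism of correspondences. -/
def UnitarilyEquiv : Prop :=
  ∃ U : K ≃ₗ[ℂ] L, (∀ (a : A) x, U (a • x) = a • U x) ∧
    (∀ (a : A) x, U (MulOpposite.op a • x) = MulOpposite.op a • U x) ∧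
    ∀ x y, L.ip (U x) (U y) = K.ip x y

/-- A left `A`-valued inner product on `K`, making `K` a left inner product `A`-module on which the
right action of `A` is by `⋆`-adjointable operators. -/
structure LeftInnerProduct where
  lip : K → K → A
  lip_add_left : ∀ x y z, lip (x + y) z = lip x z + lip y z
  lip_smul_left : ∀ (a : A) x y, lip (a • x) y = a * lip x y
  star_lip : ∀ x y, star (lip x y) = lip y x
  lip_self_nonneg : ∀ x, 0 ≤ lip x x
  lip_self_eq_zero : ∀ x, lip x x = 0 → x = 0
  lip_op_smul_left : ∀ (a : A) x y,
    lip (MulOpposite.op a • x) y = lip x (MulOpposite.op (star a) • y)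

/-- `K` is bi-Hilbertian: it has a left inner product that induces the same topology as the right
one (for norms on a vector space: the two norms are equivalent). -/
def IsBiHilbertian : Prop :=
  ∃ S : LeftInnerProduct K, ∃ c C : ℝ, 0 < c ∧ 0 < C ∧
    ∀ x, c * ‖x‖ ≤ √‖S.lip x x‖ ∧ √‖S.lip x x‖ ≤ C * ‖x‖

/-- `K` is an object of `Bim_fgp(A)`: bi-Hilbertian, and finitely generated projective as a right
`A`-module. -/
structure IsBimFgp : Prop where
  biHilbertian : IsBiHilbertian K
  finite : Module.Finite Aᵐᵒᵖ K
  projective : Module.Projective Aᵐᵒᵖ K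

/-- `End_{A-A}(K) = ℂ`. -/
structure IsIrreducible : Prop where
  nontrivial : Nontrivial K
  scalar : ∀ f : homSpace K K, ∃ c : ℂ, ∀ x, f.1 x = c • x

end Corr

variable (A) in
/-- The irreducible objects of `Bim_fgp(A)`. A finitely generated right `A`-module is in bijection
with a quotient of some `A ^ n`, so that carriers in the universe of `A` suffice. -/
structure IrrObj where
  corr : Corr.{u, u} A
  fgp : corr.IsBimFgp
  irreducible : corr.IsIrreducible

/-- Two irreducible objects are identified if they are unitarily isomorphic. -/
instance IrrObj.setoid : Setoid (IrrObj.{u} A) where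
  r K L := Corr.UnitarilyEquiv K.corr L.corr
  iseqv :=
    { refl := fun K => ⟨LinearEquiv.refl ℂ _, fun _ _ => rfl, fun _ _ => rfl, fun _ _ => rfl⟩
      symm := by
        rintro K L ⟨U, h1, h2, h3⟩
        refine ⟨U.symm, fun a x => ?_, fun a x => ?_, fun x y => ?_⟩
        · apply U.injective; rw [h1, U.apply_symm_apply, U.apply_symm_apply]
        · apply U.injective; rw [h2, U.apply_symm_apply, U.apply_symm_apply]
        · rw [← h3, U.apply_symm_apply, U.apply_symm_apply]
      trans := by
        rintro K L M ⟨U, h1, h2, h3⟩ ⟨V, g1, g2, g3⟩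
        refine ⟨U.trans V, fun a x => ?_, fun a x => ?_, fun x y => ?_⟩
        · simp only [LinearEquiv.trans_apply, h1, g1]
        · simp only [LinearEquiv.trans_apply, h2, g2]
        · simp only [LinearEquiv.trans_apply, h3, g3] }

variable (A) in
/-- `Irr(A)`, the set of isomorphism classes of irreducible objects of `Bim_fgp(A)`. -/
def Irr : Type (u + 1) := Quotient (IrrObj.setoid (A := A))

/-- A representative of an isomorphism class. -/
def Irr.rep (k : Irr A) : IrrObj A := Quotient.out k

/-- `Hom_{A-A}(K, E)` for `K` irreducible. It is a Hilbert space below, `⟨f, g⟩` being the scalar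
`f* g` in `End_{A-A}(K) = ℂ`. -/
def HilbHom (K : IrrObj A) (E : Corr.{u, v} A) : Type (max u v) := Corr.homSpace K.corr E

namespace HilbHom

open Corr

variable {K : IrrObj A} {E : Corr.{u, v} A}

instance : AddCommGroup (HilbHom K E) := inferInstanceAs (AddCommGroup (Corr.homSpace K.corr E))
instance : Module ℂ (HilbHom K E) := inferInstanceAs (Module ℂ (Corr.homSpace K.corr E))

/-- An element of `HilbHom K E`, as a morphism of correspondences. -/
def toHom (f : HilbHom K E) : Corr.homSpace K.corr E := f

theorem exists_scalar (f g : HilbHom K E) :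
    ∃ c : ℂ, ∀ x, (adj f.toHom).1 (g.toHom.1 x) = c • x := by
  refine K.irreducible.scalar ⟨(adj f.toHom).1 ∘ₗ g.toHom.1, fun a x => ?_, fun a x => ?_,
    fun x => (adj g.toHom).1 (f.toHom.1 x), fun x y => ?_⟩
  · rw [LinearMap.comp_apply, g.toHom.2.1, (adj f.toHom).2.1]; rfl
  · rw [LinearMap.comp_apply, g.toHom.2.2.1, (adj f.toHom).2.2.1]; rfl
  · rw [LinearMap.comp_apply, ip_adj_left, ip_adj_right]

instance : Inner ℂ (HilbHom K E) := ⟨fun f g => (exists_scalar f g).choose⟩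

theorem adj_comp_apply (f g : HilbHom K E) (x : K.corr) :
    (adj f.toHom).1 (g.toHom.1 x) = inner ℂ f g • x :=
  (exists_scalar f g).choose_spec x

theorem ip_apply_apply (f g : HilbHom K E) (x y : K.corr) :
    E.ip (f.toHom.1 x) (g.toHom.1 y) = inner ℂ f g • K.corr.ip x y := by
  rw [← ip_adj_right, adj_comp_apply, PreCorr.ip_smul_right]

theorem exists_ip_ne_zero (K : IrrObj A) : ∃ x : K.corr, K.corr.ip x x ≠ 0 := by
  have := K.irreducible.nontrivial
  obtain ⟨x, hx⟩ := exists_ne (0 : K.corr)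
  exact ⟨x, fun h => hx (K.corr.definite x h)⟩

theorem inner_eq {f g : HilbHom K E} {c : ℂ}
    (h : ∀ x y, E.ip (f.toHom.1 x) (g.toHom.1 y) = c • K.corr.ip x y) : inner ℂ f g = c := by
  obtain ⟨x, hx⟩ := exists_ip_ne_zero K
  have := h x x
  rw [ip_apply_apply] at this
  exact smul_left_injective ℂ hx this

/-- The axioms of an inner product. -/
@[reducible] def core : InnerProductSpace.Core ℂ (HilbHom K E) where
  conj_inner_symm f g := by
    symm
    refine inner_eq fun x y => ?_
    rw [← PreCorr.star_ip, ip_apply_apply, star_smul, PreCorr.star_ip]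
    rfl
  re_inner_nonneg f := by
    obtain ⟨x, hx⟩ := exists_ip_ne_zero K
    set p := K.corr.ip x x with hp
    have hp0 : 0 ≤ p := PreCorr.ip_self_nonneg _ _
    have h1 : 0 ≤ inner ℂ f f • p := by
      rw [hp, ← ip_apply_apply]; exact PreCorr.ip_self_nonneg _ _
    have h2 : inner ℂ f f = ((inner ℂ f f).re : ℂ) := by
      have hs : star (inner ℂ f f) • p = inner ℂ f f • p := by
        have := (IsSelfAdjoint.of_nonneg h1).star_eq
        rwa [star_smul, (IsSelfAdjoint.of_nonneg hp0).star_eq] at this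
      have := smul_left_injective ℂ hx hs
      exact (Complex.conj_eq_iff_re.1 this).symm
    change 0 ≤ (inner ℂ f f).re
    by_contra! hneg
    rw [h2] at h1
    have h3 : 0 ≤ (inner ℂ f f).re • p := by rwa [Complex.coe_smul] at h1
    have h4 : (inner ℂ f f).re • p ≤ 0 := smul_nonpos_of_nonpos_of_nonneg hneg.le hp0
    rcases smul_eq_zero.1 (le_antisymm h4 h3) with h | h
    · exact hneg.ne h
    · exact hx h
  add_left f g h := by
    refine inner_eq fun x y => ?_
    rw [add_smul, ← ip_apply_apply, ← ip_apply_apply, ← PreCorr.ip_add_left]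
    rfl
  smul_left f g c := by
    refine inner_eq fun x y => ?_
    rw [mul_smul, ← ip_apply_apply]
    exact PreCorr.ip_smul_left _ _ _ _
  definite f hf := by
    refine Subtype.ext (LinearMap.ext fun x => E.definite _ ?_)
    have := ip_apply_apply f f x x
    rw [hf, zero_smul] at this
    exact this

instance : NormedAddCommGroup (HilbHom K E) := core.toNormedAddCommGroup

instance : InnerProductSpace ℂ (HilbHom K E) := InnerProductSpace.ofCore core.toCore

theorem norm_apply (f : HilbHom K E) (x : K.corr) : ‖f.toHom.1 x‖ = ‖f‖ * ‖x‖ := by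
  refine (pow_left_inj₀ (norm_nonneg _) (by positivity) two_ne_zero).1 ?_
  rw [mul_pow, PreCorr.norm_sq, PreCorr.norm_sq]
  have h := ip_apply_apply f f x x
  change E.toPreCorr.ip _ _ = _ at h
  rw [h, norm_smul, inner_self_eq_norm_sq_to_K]
  simp

theorem norm_adj_apply_le (f : HilbHom K E) (y : E) : ‖(adj f.toHom).1 y‖ ≤ ‖f‖ * ‖y‖ := by
  have h1 : ‖(adj f.toHom).1 y‖ ^ 2 ≤ (‖f‖ * ‖(adj f.toHom).1 y‖) * ‖y‖ := by
    rw [PreCorr.norm_sq, ← norm_apply]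
    have h := ip_adj_right f.toHom ((adj f.toHom).1 y) y
    change K.corr.toPreCorr.ip _ _ = _ at h
    rw [h]
    exact PreCorr.norm_ip_le _ _ _
  by_contra! hlt
  have : 0 ≤ ‖f‖ * ‖y‖ := by positivity
  nlinarith

theorem adj_sub_apply (f g : HilbHom K E) (y : E) :
    (adj (f - g).toHom).1 y = (adj f.toHom).1 y - (adj g.toHom).1 y := by
  refine ext_ip fun x => ?_
  rw [ip_adj_right, PreCorr.ip_sub_right]
  refine Eq.trans ?_ (congrArg₂ _ (ip_adj_right f.toHom x y).symm (ip_adj_right g.toHom x y).symm)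
  exact PreCorr.ip_sub_left _ _ _ _

open Filter Topology in
instance : CompleteSpace (HilbHom K E) := by
  refine Metric.complete_of_cauchySeq_tendsto fun F hF => ?_
  have hF1 : ∀ x, CauchySeq fun n => (F n).toHom.1 x := fun x => by
    rw [Metric.cauchySeq_iff'] at hF ⊢
    intro ε hε
    obtain ⟨N, hN⟩ := hF (ε / (‖x‖ + 1)) (by positivity)
    refine ⟨N, fun n hn => ?_⟩
    have h := hN n hn
    rw [dist_eq_norm] at h ⊢
    have h2 : (F n).toHom.1 x - (F N).toHom.1 x = (F n - F N).toHom.1 x := rfl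
    rw [h2, norm_apply]
    rw [lt_div_iff₀ (by positivity)] at h
    nlinarith [norm_nonneg (F n - F N), norm_nonneg x]
  have hF2 : ∀ y, CauchySeq fun n => (adj (F n).toHom).1 y := fun y => by
    rw [Metric.cauchySeq_iff'] at hF ⊢
    intro ε hε
    obtain ⟨N, hN⟩ := hF (ε / (‖y‖ + 1)) (by positivity)
    refine ⟨N, fun n hn => ?_⟩
    have h := hN n hn
    rw [dist_eq_norm] at h ⊢
    rw [← adj_sub_apply]
    refine (norm_adj_apply_le _ _).trans_lt ?_
    rw [lt_div_iff₀ (by positivity)] at h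
    nlinarith [norm_nonneg (F n - F N), norm_nonneg y]
  choose f hf using fun x => cauchySeq_tendsto_of_complete (hF1 x)
  choose g hg using fun y => cauchySeq_tendsto_of_complete (hF2 y)
  have hmor : IsMorphism (linearMapOfTendsto f (fun n => (F n).toHom.1) (tendsto_pi_nhds.2 hf)) := by
    refine ⟨fun a x => ?_, fun a x => ?_, g, fun x y => ?_⟩
    · refine tendsto_nhds_unique (hf (a • x)) ?_
      simp_rw [(F _).toHom.2.1]
      exact (hf x).const_smul a
    · refine tendsto_nhds_unique (hf (MulOpposite.op a • x)) ?_
      simp_rw [(F _).toHom.2.2.1]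
      exact (hf x).const_smul (MulOpposite.op a)
    · have h1 : Tendsto (fun n => E.ip ((F n).toHom.1 x) y) atTop (𝓝 (E.ip (f x) y)) :=
        (E.toPreCorr.continuous_ip.tendsto (f x, y)).comp ((hf x).prodMk_nhds tendsto_const_nhds)
      have h2 : Tendsto (fun n => K.corr.ip x ((adj (F n).toHom).1 y)) atTop
          (𝓝 (K.corr.ip x (g y))) :=
        (K.corr.toPreCorr.continuous_ip.tendsto (x, g y)).comp
          (tendsto_const_nhds.prodMk_nhds (hg y))
      simp_rw [ip_adj_right] at h2
      exact tendsto_nhds_unique h1 h2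
  let f' : HilbHom K E := ⟨_, hmor⟩
  refine ⟨f', ?_⟩
  obtain ⟨x, hx⟩ := exists_ip_ne_zero K
  have hx0 : ‖x‖ ≠ 0 := fun h => hx (by
    rw [← norm_eq_zero, ← PreCorr.norm_sq, h]; simp)
  have h3 : Tendsto (fun n => ‖F n - f'‖ * ‖x‖) atTop (𝓝 0) := by
    have h4 := (tendsto_iff_norm_sub_tendsto_zero.1 (hf x))
    refine h4.congr fun n => ?_
    rw [← norm_apply]; rfl
  rw [tendsto_iff_norm_sub_tendsto_zero]
  have h5 := h3.mul_const ‖x‖⁻¹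
  simpa [mul_assoc, hx0] using h5

end HilbHom
namespace PreCorr

section tensor

variable (K : PreCorr.{u, v} A) (H : Type w) [NormedAddCommGroup H] [InnerProductSpace ℂ H]

/-- The sesquilinear form on `K ⊙ H` with `⟨x ⊗ h, y ⊗ k⟩ = ⟨h, k⟩ ⟨x, y⟩`. -/
def tensorIp : (K ⊗[ℂ] H) →ₗ⋆[ℂ] (K ⊗[ℂ] H) →ₗ[ℂ] A :=
  (TensorProduct.lift (TensorProduct.mapBilinear (.id ℂ) K H A ℂ)).compr₂
    (TensorProduct.rid ℂ A).toLinearMap ∘ₛₗ TensorProduct.map K.ipₛₗ (innerₛₗ ℂ)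

theorem tensorIp_tmul (x y : K) (h k : H) :
    K.tensorIp H (x ⊗ₜ h) (y ⊗ₜ k) = inner ℂ h k • K.ip x y := rfl

theorem star_tensorIp (x y : K ⊗[ℂ] H) : star (K.tensorIp H x y) = K.tensorIp H y x := by
  induction x with
  | zero => simp
  | add x x' hx hx' => simp [hx, hx']
  | tmul x h =>
    induction y with
    | zero => simp
    | add y y' hy hy' => simp [hy, hy']
    | tmul y k =>
      rw [tensorIp_tmul, tensorIp_tmul, star_smul, K.star_ip]
      congr 1
      exact inner_conj_symm k h

theorem tensorIp_op_smul_right (a : A) (x y : K ⊗[ℂ] H) :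
    K.tensorIp H x (MulOpposite.op a • y) = K.tensorIp H x y * a := by
  induction x with
  | zero => simp
  | add x x' hx hx' => simp [hx, hx', add_mul]
  | tmul x h =>
    induction y with
    | zero => simp
    | add y y' hy hy' => simp [hy, hy', add_mul]
    | tmul y k =>
      rw [TensorProduct.smul_tmul', tensorIp_tmul, tensorIp_tmul, K.ip_op_smul_right,
        smul_mul_assoc]

theorem tensorIp_left_smul (a : A) (x y : K ⊗[ℂ] H) :
    K.tensorIp H (a • x) y = K.tensorIp H x (star a • y) := by
  induction x with
  | zero => simp
  | add x x' hx hx' => simp [hx, hx']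
  | tmul x h =>
    induction y with
    | zero => simp
    | add y y' hy hy' => simp [hy, hy']
    | tmul y k =>
      rw [TensorProduct.smul_tmul', TensorProduct.smul_tmul', tensorIp_tmul, tensorIp_tmul,
        K.ip_left_smul]

theorem tensorIp_self_nonneg (x : K ⊗[ℂ] H) : 0 ≤ K.tensorIp H x x := by
  obtain ⟨s, rfl⟩ := TensorProduct.exists_finset x
  classical
  obtain ⟨m, B, hB⟩ := Matrix.posSemidef_iff_eq_sum_vecMulVec.mp
    (Matrix.posSemidef_gram ℂ (fun i : s => i.1.2))
  have hG : ∀ i j : s, inner ℂ i.1.2 j.1.2 = ∑ l, B l i * star (B l j) := fun i j => by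
    have := congrFun (congrFun hB i) j
    rw [Matrix.gram_apply] at this
    rw [this, Matrix.sum_apply]
    rfl
  have key : K.tensorIp H (∑ i ∈ s, i.1 ⊗ₜ[ℂ] i.2) (∑ i ∈ s, i.1 ⊗ₜ[ℂ] i.2)
      = ∑ l, K.ip (∑ i : s, star (B l i) • i.1.1) (∑ i : s, star (B l i) • i.1.1) := by
    rw [← Finset.sum_coe_sort s]
    simp only [map_sum, LinearMap.sum_apply, tensorIp_tmul, hG, Finset.sum_smul]
    have hr : ∀ l, K.ip (∑ i : s, star (B l i) • i.1.1) (∑ i : s, star (B l i) • i.1.1)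
        = ∑ j : s, ∑ i : s, (B l i * star (B l j)) • K.ip i.1.1 j.1.1 := fun l => by
      rw [← ipₛₗ_apply]
      simp only [map_sum, LinearMap.sum_apply, map_smul, map_smulₛₗ, LinearMap.smul_apply,
        ipₛₗ_apply, RCLike.star_def, RCLike.conj_conj]
      refine Finset.sum_congr rfl fun j _ => ?_
      rw [Finset.smul_sum]
      exact Finset.sum_congr rfl fun i _ => by rw [smul_smul, mul_comm]
    simp only [hr]
    symm
    rw [Finset.sum_comm]
    exact Finset.sum_congr rfl fun j _ => Finset.sum_comm
  rw [key]
  exact Finset.sum_nonneg fun l _ => K.ip_self_nonneg _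

/-- The algebraic tensor product `K ⊙ H`, with the `A`-`A`-bimodule structure of the first leg. -/
def tensor : PreCorr.{u, max v w} A where
  carrier := K ⊗[ℂ] H
  ip x y := K.tensorIp H x y
  ip_add_right _ y z := map_add _ y z
  ip_smul_right c _ y := map_smul _ c y
  ip_op_smul_right := K.tensorIp_op_smul_right H
  star_ip := K.star_tensorIp H
  ip_self_nonneg := K.tensorIp_self_nonneg H
  ip_left_smul := K.tensorIp_left_smul H

end tensor

section directSum

variable {ι : Type z} (V : ι → PreCorr.{u, v} A)

open Classical in
/-- `⟨x, y⟩ = ∑ i, ⟨x i, y i⟩` for finitely supported families. -/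
def directSumIp (x y : Π₀ i, V i) : A := ∑ i ∈ x.support ∪ y.support, (V i).ip (x i) (y i)

open Classical in
theorem directSumIp_eq (x y : Π₀ i, V i) (s : Finset ι) (h : x.support ⊆ s ∨ y.support ⊆ s) :
    directSumIp V x y = ∑ i ∈ s, (V i).ip (x i) (y i) := by
  have h0 : ∀ i, x i = 0 ∨ y i = 0 → (V i).ip (x i) (y i) = 0 := by
    rintro i (h | h) <;> rw [h] <;> simp [← ipₛₗ_apply]
  have h1 : directSumIp V x y = ∑ i ∈ (x.support ∪ y.support) ∪ s, (V i).ip (x i) (y i) := by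
    refine Finset.sum_subset Finset.subset_union_left fun i _ hi => h0 i ?_
    simp only [Finset.mem_union, DFinsupp.mem_support_iff, not_or, not_not] at hi
    exact Or.inl hi.1
  rw [h1]
  symm
  refine Finset.sum_subset Finset.subset_union_right fun i _ hi => h0 i ?_
  rcases h with h | h
  · exact Or.inl (DFinsupp.notMem_support_iff.1 fun h' => hi (h h'))
  · exact Or.inr (DFinsupp.notMem_support_iff.1 fun h' => hi (h h'))

open Classical in
/-- The algebraic direct sum `⨁ i, V i` with `⟨x, y⟩ = ∑ i, ⟨x i, y i⟩`. -/
def directSum : PreCorr.{u, max v z} A where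
  carrier := Π₀ i, V i
  bimodule := ⟨fun a b x => by ext i; exact smul_comm a b (x i)⟩
  leftTower := ⟨fun c a x => by ext i; exact smul_assoc c a (x i)⟩
  rightTower := ⟨fun c a x => by ext i; exact smul_assoc c a (x i)⟩
  ip := directSumIp V
  ip_add_right x y z := by
    rw [directSumIp_eq V x _ x.support (Or.inl subset_rfl),
      directSumIp_eq V x y x.support (Or.inl subset_rfl),
      directSumIp_eq V x z x.support (Or.inl subset_rfl), ← Finset.sum_add_distrib]
    exact Finset.sum_congr rfl fun i _ => (V i).ip_add_right _ _ _
  ip_smul_right c x y := by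
    rw [directSumIp_eq V x _ x.support (Or.inl subset_rfl),
      directSumIp_eq V x y x.support (Or.inl subset_rfl), Finset.smul_sum]
    exact Finset.sum_congr rfl fun i _ => (V i).ip_smul_right _ _ _
  ip_op_smul_right a x y := by
    rw [directSumIp_eq V x _ x.support (Or.inl subset_rfl),
      directSumIp_eq V x y x.support (Or.inl subset_rfl), Finset.sum_mul]
    exact Finset.sum_congr rfl fun i _ => (V i).ip_op_smul_right _ _ _
  star_ip x y := by
    rw [directSumIp_eq V x y x.support (Or.inl subset_rfl),
      directSumIp_eq V y x x.support (Or.inr subset_rfl), star_sum]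
    exact Finset.sum_congr rfl fun i _ => (V i).star_ip _ _
  ip_self_nonneg x := Finset.sum_nonneg fun i _ => (V i).ip_self_nonneg _
  ip_left_smul a x y := by
    rw [directSumIp_eq V _ y y.support (Or.inr subset_rfl),
      directSumIp_eq V x _ (x.support ∪ y.support) (Or.inl Finset.subset_union_left)]
    refine (Finset.sum_subset Finset.subset_union_right fun i _ hi => ?_).trans
      (Finset.sum_congr rfl fun i _ => (V i).ip_left_smul _ _ _)
    rw [DFinsupp.notMem_support_iff.1 hi]
    simp [← ipₛₗ_apply]

end directSum

end PreCorr

/-- A complex Hilbert space, bundled. -/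
structure HilbertSpace where
  carrier : Type w
  [normedAddCommGroup : NormedAddCommGroup carrier]
  [innerProductSpace : InnerProductSpace ℂ carrier]
  [completeSpace : CompleteSpace carrier]

attribute [instance] HilbertSpace.normedAddCommGroup HilbertSpace.innerProductSpace
  HilbertSpace.completeSpace

instance : CoeSort HilbertSpace.{w} (Type w) := ⟨HilbertSpace.carrier⟩

/-- The `ℓ^∞`-product of the `⋆`-algebras `B(H i)`. -/
def BoundedProd {ι : Type z} (H : ι → HilbertSpace.{w}) : Type (max z w) :=
  lp (fun i => H i →L[ℂ] H i) ∞

namespace BoundedProd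

variable {ι : Type z} (H : ι → HilbertSpace.{w})

instance : NonUnitalRing (BoundedProd H) :=
  inferInstanceAs (NonUnitalRing (lp (fun i => H i →L[ℂ] H i) ∞))

instance : Module ℂ (BoundedProd H) :=
  inferInstanceAs (Module ℂ (lp (fun i => H i →L[ℂ] H i) ∞))

instance : StarRing (BoundedProd H) :=
  inferInstanceAs (StarRing (lp (fun i => H i →L[ℂ] H i) ∞))

end BoundedProd

variable (A) in
/-- An object of the unitary ind-completion `Hilb(Bim_fgp(A))`, given by its values on `Irr(A)`,
which determine it up to isomorphism and can be prescribed arbitrarily. -/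
abbrev HilbObj := Irr A → HilbertSpace.{w}

/-- The realization `|H| = ⨁ k, k ⊗ H k` (`ℓ^2`-direct sum over `k` in `Irr(A)` of amplified
correspondences): the completion of the algebraic direct sum of the algebraic tensor products. -/
def HilbObj.realization (H : HilbObj.{u, w} A) : Corr.{u, max (u + 1) w} A :=
  (PreCorr.directSum fun k : Irr A => PreCorr.tensor k.rep.corr.toPreCorr (H k)).completion

/-- The Hilbert space object `H_E` of `E`, with `H_E(k) = Hom_{A-A}(k, E)`. -/
def Corr.hilbObj (E : Corr.{u, v} A) : HilbObj.{u, max u v} A :=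
  fun k => { carrier := HilbHom k.rep E }

/-- `E` belongs to `Hilb(Bim_fgp(A))`: it is isomorphic to the realization of an object. -/
def Corr.IsHilb (E : Corr.{u, v} A) : Prop :=
  ∃ H : HilbObj.{u, max u v} A, E.UnitarilyEquiv H.realization

variable (A) in
/-- A unital inclusion `A ⊂ D` of unital C⋆-algebras, with a faithful conditional expectation. -/
structure FaithfulInclusion (D : Type v) [CStarAlgebra D] [PartialOrder D] [StarOrderedRing D] where
  incl : A →⋆ₐ[ℂ] D
  expect : D →ₚ[ℂ] A
  incl_injective : Function.Injective incl
  expect_incl : ∀ a, expect (incl a) = a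
  expect_bimodule : ∀ a b d, expect (incl a * d * incl b) = a * expect d * b
  faithful : ∀ d, expect (star d * d) = 0 → d = 0

namespace FaithfulInclusion

variable {D : Type v} [CStarAlgebra D] [PartialOrder D] [StarOrderedRing D]
  (S : FaithfulInclusion A D)

/-- `D` as an `A`-`A`-bimodule, with `⟨x, y⟩ = E(x* y)`. -/
def preCorr : PreCorr.{u, v} A where
  carrier := D
  leftModule := Module.compHom D (S.incl : A →+* D)
  rightModule := Module.compHom D (S.incl : A →+* D).op
  leftTower := @IsScalarTower.mk ℂ A D _ (Module.compHom D (S.incl : A →+* D)).toSMul _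
    fun c a x => by
      change S.incl (c • a) * x = c • (S.incl a * x)
      rw [map_smul, smul_mul_assoc]
  rightTower := @IsScalarTower.mk ℂ Aᵐᵒᵖ D _ (Module.compHom D (S.incl : A →+* D).op).toSMul _
    fun c a x => by
      change x * S.incl (c • a.unop) = c • (x * S.incl a.unop)
      rw [map_smul, mul_smul_comm]
  bimodule := @SMulCommClass.mk A Aᵐᵒᵖ D (Module.compHom D (S.incl : A →+* D)).toSMul
    (Module.compHom D (S.incl : A →+* D).op).toSMul fun a b x => (mul_assoc _ _ _).symm
  ip x y := S.expect (star x * y)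
  ip_add_right x y z := by rw [mul_add, map_add]
  ip_smul_right c x y := by rw [mul_smul_comm, map_smul]
  ip_op_smul_right a x y := by
    change S.expect (star x * (y * S.incl a)) = S.expect (star x * y) * a
    have h := S.expect_bimodule 1 a (star x * y)
    rwa [map_one, one_mul, one_mul, mul_assoc] at h
  star_ip x y := by rw [← map_star, star_mul, star_star]
  ip_self_nonneg x := S.expect.map_nonneg (star_mul_self_nonneg x)
  ip_left_smul a x y := by
    change S.expect (star (S.incl a * x) * y) = S.expect (star x * (S.incl (star a) * y))
    rw [star_mul, map_star, mul_assoc]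

/-- The Hilbert completion of `D` for `⟨x, y⟩ = E(x* y)`, an `A`-`A`-correspondence. -/
def hilb : Corr.{u, v} A := S.preCorr.completion

/-- The completion `ℰ` of `D` is isomorphic to `|H_ℰ|` as a correspondence. -/
def IsIndInclusion : Prop := S.hilb.UnitarilyEquiv S.hilb.hilbObj.realization

end FaithfulInclusion

end

end CStarCorr

namespace CStarCorr

noncomputable section

open scoped TensorProduct ComplexOrder ENNReal

variable {A : Type u} [CStarAlgebra A] [PartialOrder A] [StarOrderedRing A]

namespace PreCorr

/-! Both sides of the equivalence turn on one property of a correspondence `E`: the ranges of all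
morphisms from irreducible objects to `E` span a dense subspace, `irrSpan`.

If `E` is isomorphic to `|H|` for any family `H` whatsoever, density holds: each elementary tensor
`x ⊗ h` is the value at `x` of the morphism `inclusion k h`, and density passes along surjective
morphisms (`dense_irrSpan_of_surjective`). Conversely, evaluation `x ⊗ f ↦ f x` preserves inner
products on the algebraic direct sum. For one irreducible object this is the definition of the inner
product on the Hom-space; for two different ones, Schur's lemma makes the ranges orthogonal. If the
span is dense, evaluation therefore extends to a unitary from `|H_E|` onto `E`
(`exists_unitary_of_dense`). So membership in `Hilb(Bim_fgp(A))` already forces `E ≅ |H_E|`, and the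
range condition at the projection `1` gives an ind-inclusion.

For the other direction and the last claim, `End(E)` acts by composition on each Hilbert space
`Hom(k, E)` (`homRep`). Density makes these representations jointly faithful (`ext_homRep`), and
every uniformly bounded family of operators comes from an endomorphism, namely its amplification `id
⊗ S k` carried over by the evaluation unitary (`exists_homRep_eq`). Hence `End(E)` is the bounded
product of the algebras `B(Hom(k, E))`. The projections `P k` are the families equal to `1` at `k`
and `0` elsewhere, and their algebraic properties are read off componentwise. Strict convergence is
evident on the span and extends because partial sums are contractions. Finally, a projection maps
`E` onto its range, so the range inherits density and is itself a realization. -/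

theorem continuous_ip_comp (V : PreCorr.{u, v} A) {X : Type*} [TopologicalSpace X] {f g : X → V}
    (hf : Continuous f) (hg : Continuous g) : Continuous fun x => V.ip (f x) (g x) :=
  V.continuous_ip.comp (hf.prodMk hg)

/-! ### Extension of maps by continuity to the completion. -/

variable (V : PreCorr.{u, v} A)

/-- The canonical isometry from `V` to its completion. -/
def toCompletion : V →L[ℂ] V.completion :=
  LinearMap.mkContinuous
    { toFun := fun x => (show V.completion from (x : UniformSpace.Completion V))
      map_add' := UniformSpace.Completion.coe_add
      map_smul' := fun c x => UniformSpace.Completion.coe_smul c x } 1 fun x => by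
    rw [one_mul, V.completion.toPreCorr.norm_def, V.norm_def]
    exact (congrArg (fun a : A => √‖a‖) (V.completionIp_coe x x)).le

theorem ip_toCompletion (x y : V) :
    V.completion.ip (V.toCompletion x) (V.toCompletion y) = V.ip x y :=
  V.completionIp_coe x y

theorem toCompletion_smul (a : A) (x : V) : V.toCompletion (a • x) = a • V.toCompletion x :=
  UniformSpace.Completion.coe_smul a x

theorem toCompletion_op_smul (a : A) (x : V) :
    V.toCompletion (MulOpposite.op a • x) = MulOpposite.op a • V.toCompletion x :=
  UniformSpace.Completion.coe_smul (MulOpposite.op a) x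

theorem isometry_toCompletion : Isometry V.toCompletion :=
  AddMonoidHomClass.isometry_of_norm V.toCompletion fun x => by
    rw [V.completion.toPreCorr.norm_def, V.norm_def]
    exact congrArg (fun a : A => √‖a‖) (V.completionIp_coe x x)

theorem denseRange_toCompletion : DenseRange V.toCompletion :=
  V.completionEquiv.surjective.denseRange.comp UniformSpace.Completion.denseRange_coe
    V.completionEquiv.continuous

variable {V} {L : Corr.{u, w} A}

/-- The continuous extension of a bounded linear map to the completion. -/
def extend (φ : V →L[ℂ] L) : V.completion →L[ℂ] L := φ.extend V.toCompletion

theorem extend_toCompletion (φ : V →L[ℂ] L) (x : V) : extend φ (V.toCompletion x) = φ x :=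
  ContinuousLinearMap.extend_eq _ V.denseRange_toCompletion
    V.isometry_toCompletion.isUniformInducing x

theorem extend_smul (φ : V →L[ℂ] L) (h : ∀ (a : A) x, φ (a • x) = a • φ x) (a : A)
    (x : V.completion) : extend φ (a • x) = a • extend φ x := by
  refine V.denseRange_toCompletion.induction_on (p := fun x => extend φ (a • x) = a • extend φ x) x
    (isClosed_eq ((extend φ).continuous.comp (continuous_const_smul a))
      ((extend φ).continuous.const_smul a)) fun y => ?_
  rw [← toCompletion_smul, extend_toCompletion, extend_toCompletion, h]

theorem extend_op_smul (φ : V →L[ℂ] L)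
    (h : ∀ (a : A) x, φ (MulOpposite.op a • x) = MulOpposite.op a • φ x) (a : A)
    (x : V.completion) :
    extend φ (MulOpposite.op a • x) = MulOpposite.op a • extend φ x := by
  refine V.denseRange_toCompletion.induction_on
    (p := fun x => extend φ (MulOpposite.op a • x) = MulOpposite.op a • extend φ x) x
    (isClosed_eq ((extend φ).continuous.comp (continuous_const_smul (MulOpposite.op a)))
      ((extend φ).continuous.const_smul (MulOpposite.op a))) fun y => ?_
  rw [← toCompletion_op_smul, extend_toCompletion, extend_toCompletion, h]

/-- An inner product preserving bimodule map with dense range extends to a unitary. -/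
theorem unitarilyEquiv_of_denseRange (φ : V →ₗ[ℂ] L) (hl : ∀ (a : A) x, φ (a • x) = a • φ x)
    (hr : ∀ (a : A) x, φ (MulOpposite.op a • x) = MulOpposite.op a • φ x)
    (hip : ∀ x y, L.ip (φ x) (φ y) = V.ip x y) (hd : DenseRange φ) :
    ∃ U : V.completion ≃ₗ[ℂ] L, (∀ (a : A) x, U (a • x) = a • U x) ∧
      (∀ (a : A) x, U (MulOpposite.op a • x) = MulOpposite.op a • U x) ∧
      (∀ x y, L.ip (U x) (U y) = V.completion.ip x y) ∧ ∀ x, U (V.toCompletion x) = φ x := by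
  let ψ : V →L[ℂ] L := φ.mkContinuous 1 fun x => by
    rw [one_mul, L.toPreCorr.norm_def, V.norm_def]
    exact (congrArg (fun a : A => √‖a‖) (hip x x)).le
  have hψ : ∀ x, ψ x = φ x := fun _ => rfl
  have h1 : ∀ x y, L.ip (extend ψ x) (extend ψ y) = V.completion.ip x y := fun x y => by
    refine V.denseRange_toCompletion.induction_on₂
      (p := fun x y => L.ip (extend ψ x) (extend ψ y) = V.completion.ip x y)
      (isClosed_eq (L.toPreCorr.continuous_ip_comp ((extend ψ).continuous.comp continuous_fst)
        ((extend ψ).continuous.comp continuous_snd)) V.completion.toPreCorr.continuous_ip)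
      (fun a b => ?_) x y
    rw [extend_toCompletion, extend_toCompletion, ip_toCompletion, ← hip]; rfl
  have h2 : Isometry (extend ψ) := AddMonoidHomClass.isometry_of_norm _ fun x => by
    rw [L.toPreCorr.norm_def, V.completion.toPreCorr.norm_def]
    exact congrArg (fun a : A => √‖a‖) (h1 x x)
  -- An isometry from a complete space has closed range; this range contains that of `φ`, so it is
  -- also dense.
  have h3 : Function.Surjective (extend ψ) := by
    rw [← Set.range_eq_univ, ← h2.isClosedEmbedding.isClosed_range.closure_eq]
    refine (hd.mono ?_).closure_eq
    rintro _ ⟨x, rfl⟩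
    exact ⟨V.toCompletion x, extend_toCompletion ψ x⟩
  refine ⟨LinearEquiv.ofBijective (extend ψ).toLinearMap ⟨h2.injective, h3⟩,
    extend_smul ψ hl, extend_op_smul ψ hr, h1, extend_toCompletion ψ⟩

end PreCorr

/-! ### Morphisms of correspondences: boundedness, composition, unitaries. -/

namespace Corr

variable {K : Corr.{u, v} A} {L : Corr.{u, w} A} {M : Corr.{u, z} A}

/-- Adjointable maps are bounded. -/
theorem continuous_hom (f : homSpace K L) : Continuous f.1 := by
  -- The closed graph theorem applies: pairing with `z` and moving `f` to the other side by the
  -- adjoint identifies any limit of `f (s n)` with `f x`.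
  refine LinearMap.continuous_of_seq_closed_graph f.1 fun s x y hs hfs => ext_ip fun z => ?_
  have h1 := ((L.toPreCorr.continuous_ip_comp (continuous_const (y := z)) continuous_id).tendsto
    y).comp hfs
  have h2 := ((K.toPreCorr.continuous_ip_comp (continuous_const (y := (adj f).1 z))
    continuous_id).tendsto x).comp hs
  have h3 : L.ip z (f.1 x) = K.ip ((adj f).1 z) x := (ip_adj_left f z x).symm
  rw [h3]
  refine tendsto_nhds_unique h1 (h2.congr fun n => ?_)
  exact ip_adj_left f z (s n)

/-- Composition of morphisms. -/
def comp (g : homSpace L M) (f : homSpace K L) : homSpace K M :=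
  ⟨g.1 ∘ₗ f.1, fun a x => by simp only [LinearMap.comp_apply, f.2.1, g.2.1],
    fun a x => by simp only [LinearMap.comp_apply, f.2.2.1, g.2.2.1],
    fun x => (adj f).1 ((adj g).1 x), fun x y => by
      rw [LinearMap.comp_apply, ip_adj_right, ip_adj_right]⟩

theorem comp_apply (g : homSpace L M) (f : homSpace K L) (x : K) :
    (comp g f).1 x = g.1 (f.1 x) := rfl

/-- An endomorphism as an element of the Hom-space. -/
def endHom (T : endAlg K) : homSpace K K := ⟨T.1, T.2⟩

theorem UnitarilyEquiv.symm (h : UnitarilyEquiv K L) : UnitarilyEquiv L K := by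
  obtain ⟨U, h1, h2, h3⟩ := h
  refine ⟨U.symm, fun a x => U.injective ?_, fun a x => U.injective ?_, fun x y => ?_⟩
  · rw [h1, U.apply_symm_apply, U.apply_symm_apply]
  · rw [h2, U.apply_symm_apply, U.apply_symm_apply]
  · rw [← h3, U.apply_symm_apply, U.apply_symm_apply]

theorem UnitarilyEquiv.trans (h : UnitarilyEquiv K L) (h' : UnitarilyEquiv L M) :
    UnitarilyEquiv K M := by
  obtain ⟨U, h1, h2, h3⟩ := h
  obtain ⟨V, g1, g2, g3⟩ := h'
  refine ⟨U.trans V, fun a x => ?_, fun a x => ?_, fun x y => ?_⟩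
  · simp only [LinearEquiv.trans_apply, h1, g1]
  · simp only [LinearEquiv.trans_apply, h2, g2]
  · simp only [LinearEquiv.trans_apply, h3, g3]

theorem unitarilyEquiv_range_one (hP : IsStarProjection (1 : endAlg K)) :
    UnitarilyEquiv (range (1 : endAlg K) hP) K :=
  ⟨LinearEquiv.ofBijective (LinearMap.range (1 : endAlg K).1).subtype
    ⟨Subtype.val_injective, fun x => ⟨⟨x, x, rfl⟩, rfl⟩⟩, fun _ _ => rfl, fun _ _ => rfl,
    fun _ _ => rfl⟩

/-- A unitary isomorphism as a morphism. -/
def ofUnitary (U : K ≃ₗ[ℂ] L) (h1 : ∀ (a : A) x, U (a • x) = a • U x)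
    (h2 : ∀ (a : A) x, U (MulOpposite.op a • x) = MulOpposite.op a • U x)
    (h3 : ∀ x y, L.ip (U x) (U y) = K.ip x y) : homSpace K L :=
  ⟨U.toLinearMap, h1, h2, U.symm, fun x y => by
    rw [← h3 x, U.apply_symm_apply]; rfl⟩

end Corr

/-! ### Schur's lemma and orthogonality of different irreducible objects. -/

/-- Schur's lemma: a nonzero morphism between irreducible objects is a multiple of a unitary. -/
theorem IrrObj.unitarilyEquiv_of_ne_zero {K L : IrrObj A} (f : Corr.homSpace K.corr L.corr)
    (hf : f ≠ 0) : Corr.UnitarilyEquiv K.corr L.corr := by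
  let F : HilbHom K L.corr := f
  have hF : ‖F‖ ≠ 0 := norm_ne_zero_iff.2 hf
  -- The Hilbert norm of a morphism is its scaling factor, so normalizing gives an isometry with `G*
  -- G = 1`.
  let G : HilbHom K L.corr := ((‖F‖⁻¹ : ℝ) : ℂ) • F
  have hG : ‖G‖ = 1 := by
    rw [norm_smul, Complex.norm_real, norm_inv, norm_norm, inv_mul_cancel₀ hF]
  have hip : ∀ x y, L.corr.ip (G.toHom.1 x) (G.toHom.1 y) = K.corr.ip x y := fun x y => by
    rw [HilbHom.ip_apply_apply, inner_self_eq_norm_sq_to_K, hG]; simp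
  have hGG : ∀ x, (Corr.adj G.toHom).1 (G.toHom.1 x) = x := fun x => by
    rw [HilbHom.adj_comp_apply, inner_self_eq_norm_sq_to_K, hG]; simp
  obtain ⟨c, hc⟩ := L.irreducible.scalar (Corr.comp G.toHom (Corr.adj G.toHom))
  -- `G G*` is a scalar because `L` is irreducible, and it fixes the nonzero vector `G x`.
  have hc1 : c = 1 := by
    obtain ⟨x, hx⟩ := HilbHom.exists_ip_ne_zero K
    have h := hc (G.toHom.1 x)
    rw [Corr.comp_apply, hGG] at h
    have hne : G.toHom.1 x ≠ 0 := fun h0 => hx (by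
      rw [← hip, h0, ← PreCorr.ipₛₗ_apply, map_zero])
    refine smul_left_injective ℂ hne ?_
    simp only [← h, one_smul]
  refine ⟨LinearEquiv.ofBijective G.toHom.1 ⟨fun x y h => ?_, fun y => ?_⟩, G.toHom.2.1,
    G.toHom.2.2.1, hip⟩
  · rw [← hGG x, h, hGG]
  · exact ⟨(Corr.adj G.toHom).1 y, by rw [← Corr.comp_apply, hc, hc1, one_smul]⟩

theorem Irr.hom_eq_zero {k l : Irr A} (h : k ≠ l)
    (f : Corr.homSpace k.rep.corr l.rep.corr) : f = 0 := by
  by_contra hf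
  refine h ?_
  rw [← Quotient.out_eq k, ← Quotient.out_eq l]
  exact Quotient.sound (IrrObj.unitarilyEquiv_of_ne_zero f hf)

/-- The inner product is computed by `g* f`, a morphism between different irreducible objects, which
vanishes by Schur's lemma. -/
theorem HilbHom.ip_apply_apply_of_ne {E : Corr.{u, v} A} {k l : Irr A} (h : k ≠ l)
    (f : HilbHom k.rep E) (g : HilbHom l.rep E) (x : k.rep.corr) (y : l.rep.corr) :
    E.ip (f.toHom.1 x) (g.toHom.1 y) = 0 := by
  rw [← Corr.ip_adj_left, ← Corr.comp_apply, Irr.hom_eq_zero h (Corr.comp _ _)]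
  change l.rep.corr.ip 0 y = 0
  rw [← PreCorr.ipₛₗ_apply, map_zero, LinearMap.zero_apply]

/-! ### The realization `|H|`: generators, inclusions and amplified operators. -/

namespace HilbObj

variable (H : HilbObj.{u, w} A)

/-- The algebraic direct sum of the algebraic tensor products `k ⊙ H k`. -/
abbrev algebraic : PreCorr.{u, max (u + 1) w} A :=
  PreCorr.directSum fun k : Irr A => PreCorr.tensor k.rep.corr.toPreCorr (H k)

open Classical in
/-- The elementary tensor `x ⊗ h` in the summand of index `k`. -/
def gen (k : Irr A) : k.rep.corr →ₗ[ℂ] H k →ₗ[ℂ] H.algebraic :=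
  (TensorProduct.mk ℂ k.rep.corr (H k)).compr₂
    (DFinsupp.lsingle (R := ℂ) (M := fun k : Irr A => k.rep.corr ⊗[ℂ] H k) k)

-- Elementary tensors generate the algebraic direct sum additively, so identities between additive
-- expressions need checking on them only.
variable {H} in
@[elab_as_elim]
theorem gen_induction {p : H.algebraic → Prop} (v : H.algebraic) (zero : p 0)
    (add : ∀ v w, p v → p w → p (v + w)) (gen : ∀ k x h, p (H.gen k x h)) : p v := by
  classical
  refine DFinsupp.induction (p := p) v zero fun k t f _ _ hf => add _ _ ?_ hf
  refine TensorProduct.induction_on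
    (motive := fun t => p (DFinsupp.single k t : Π₀ k : Irr A, k.rep.corr ⊗[ℂ] H k)) t ?_
    (fun x h => gen k x h) fun s t hs ht => ?_
  · rw [DFinsupp.single_zero]; exact zero
  · rw [DFinsupp.single_add]; exact add _ _ hs ht

theorem smul_gen (a : A) (k : Irr A) (x : k.rep.corr) (h : H k) :
    a • H.gen k x h = H.gen k (a • x) h := by
  classical
  exact (DFinsupp.single_smul (β := fun k : Irr A => k.rep.corr ⊗[ℂ] H k) a (x ⊗ₜ h)).symm

theorem op_smul_gen (a : A) (k : Irr A) (x : k.rep.corr) (h : H k) :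
    MulOpposite.op a • H.gen k x h = H.gen k (MulOpposite.op a • x) h := by
  classical
  exact (DFinsupp.single_smul (β := fun k : Irr A => k.rep.corr ⊗[ℂ] H k)
    (MulOpposite.op a) (x ⊗ₜ h)).symm

theorem ip_gen_gen (k : Irr A) (x y : k.rep.corr) (h h' : H k) :
    H.algebraic.ip (H.gen k x h) (H.gen k y h') = inner ℂ h h' • k.rep.corr.ip x y := by
  classical
  refine (PreCorr.directSumIp_eq
    (fun k : Irr A => PreCorr.tensor k.rep.corr.toPreCorr (H k)) (H.gen k x h) (H.gen k y h')
    {k} (Or.inl DFinsupp.support_single_subset)).trans ?_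
  rw [Finset.sum_singleton]
  exact congrArg₂ (fun s t => PreCorr.tensorIp k.rep.corr.toPreCorr (H k) s t)
    (DFinsupp.single_eq_same (β := fun k : Irr A => k.rep.corr ⊗[ℂ] H k))
    (DFinsupp.single_eq_same (β := fun k : Irr A => k.rep.corr ⊗[ℂ] H k))

theorem ip_gen_gen_of_ne {k l : Irr A} (hkl : k ≠ l) (x : k.rep.corr) (h : H k)
    (y : l.rep.corr) (h' : H l) : H.algebraic.ip (H.gen k x h) (H.gen l y h') = 0 := by
  classical
  refine (PreCorr.directSumIp_eq
    (fun k : Irr A => PreCorr.tensor k.rep.corr.toPreCorr (H k)) (H.gen k x h) (H.gen l y h')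
    {k} (Or.inl DFinsupp.support_single_subset)).trans ?_
  rw [Finset.sum_singleton]
  exact (congrArg (fun t => PreCorr.tensorIp k.rep.corr.toPreCorr (H k) _ t)
    (DFinsupp.single_eq_of_ne (β := fun k : Irr A => k.rep.corr ⊗[ℂ] H k) hkl)).trans
    (map_zero (PreCorr.tensorIp k.rep.corr.toPreCorr (H k) _))

variable {H} {M : Type z} [AddCommGroup M] [Module ℂ M]

open Classical in
/-- Linear maps out of the algebraic direct sum. -/
def lift (φ : ∀ k : Irr A, k.rep.corr →ₗ[ℂ] H k →ₗ[ℂ] M) : H.algebraic →ₗ[ℂ] M :=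
  DFinsupp.lsum ℂ (M := fun k : Irr A => k.rep.corr ⊗[ℂ] H k)
    fun k => TensorProduct.lift (φ k)

theorem lift_gen (φ : ∀ k : Irr A, k.rep.corr →ₗ[ℂ] H k →ₗ[ℂ] M) (k : Irr A) (x : k.rep.corr) (h : H k) :
    lift φ (H.gen k x h) = φ k x h := by
  classical
  exact (DFinsupp.lsum_single (M := fun k : Irr A => k.rep.corr ⊗[ℂ] H k) ℂ _ k _).trans
    (TensorProduct.lift.tmul x h)

theorem lift_smul [Module A M] (φ : ∀ k : Irr A, k.rep.corr →ₗ[ℂ] H k →ₗ[ℂ] M)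
    (hφ : ∀ k (a : A) x h, φ k (a • x) h = a • φ k x h) (a : A) (v : H.algebraic) :
    lift φ (a • v) = a • lift φ v := by
  induction v using gen_induction with
  | zero => simp
  | add v w hv hw => rw [smul_add, map_add, hv, hw, map_add, smul_add]
  | gen k x h => rw [smul_gen, lift_gen, lift_gen, hφ]

theorem lift_op_smul [Module Aᵐᵒᵖ M] (φ : ∀ k : Irr A, k.rep.corr →ₗ[ℂ] H k →ₗ[ℂ] M)
    (hφ : ∀ k (a : A) x h, φ k (MulOpposite.op a • x) h = MulOpposite.op a • φ k x h) (a : A)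
    (v : H.algebraic) : lift φ (MulOpposite.op a • v) = MulOpposite.op a • lift φ v := by
  induction v using gen_induction with
  | zero => simp
  | add v w hv hw => rw [smul_add, map_add, hv, hw, map_add, smul_add]
  | gen k x h => rw [op_smul_gen, lift_gen, lift_gen, hφ]

variable (H)

theorem norm_gen (k : Irr A) (x : k.rep.corr) (h : H k) : ‖H.gen k x h‖ = ‖h‖ * ‖x‖ := by
  refine (pow_left_inj₀ (norm_nonneg _) (by positivity) two_ne_zero).1 ?_
  rw [mul_pow, PreCorr.norm_sq, PreCorr.norm_sq, ip_gen_gen, norm_smul,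
    inner_self_eq_norm_sq_to_K]
  simp

open Classical in
/-- The adjoint of `x ↦ x ⊗ h`, on the algebraic direct sum. -/
def contract (k : Irr A) (h : H k) : H.algebraic →ₗ[ℂ] k.rep.corr :=
  lift fun l => if hl : k = l then by
    subst hl
    exact (LinearMap.lsmul ℂ k.rep.corr).flip.compl₂ (innerₛₗ ℂ h)
    else 0

/-- Makes contraction the algebraic adjoint of `x ↦ x ⊗ h`; its extension to the completion is the
adjoint that `inclusion` needs in order to be a morphism. -/
theorem ip_gen_left (k : Irr A) (x : k.rep.corr) (h : H k) (v : H.algebraic) :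
    H.algebraic.ip (H.gen k x h) v = k.rep.corr.ip x (H.contract k h v) := by
  induction v using gen_induction with
  | zero => simp [← PreCorr.ipₛₗ_apply]
  | add v w hv hw => rw [PreCorr.ip_add_right, hv, hw, map_add, PreCorr.ip_add_right]
  | gen l y h' =>
    rw [contract, lift_gen]
    split_ifs with hl
    · subst hl
      rw [ip_gen_gen]
      exact (PreCorr.ip_smul_right _ _ _ _).symm
    · rw [ip_gen_gen_of_ne H hl]
      simp [← PreCorr.ipₛₗ_apply]

/-- Cauchy–Schwarz for the pairing of `v` with `H.contract k h v ⊗ h`, which computes the square of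
the norm on the left. -/
theorem norm_contract_le (k : Irr A) (h : H k) (v : H.algebraic) :
    ‖H.contract k h v‖ ≤ ‖h‖ * ‖v‖ := by
  have h1 : ‖H.contract k h v‖ ^ 2 ≤ (‖h‖ * ‖H.contract k h v‖) * ‖v‖ := by
    rw [PreCorr.norm_sq, ← norm_gen]
    have h2 := ip_gen_left H k (H.contract k h v) h v
    change _ = k.rep.corr.toPreCorr.ip _ _ at h2
    rw [← h2]
    exact PreCorr.norm_ip_le _ _ _
  by_contra! hlt
  have : 0 ≤ ‖h‖ * ‖v‖ := by positivity
  nlinarith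

/-- The morphism `x ↦ x ⊗ h` into the realization. -/
def inclusion (k : Irr A) (h : H k) : HilbHom k.rep H.realization :=
  ⟨H.algebraic.toCompletion.toLinearMap ∘ₗ (H.gen k).flip h, fun a x => by
    change H.algebraic.toCompletion (H.gen k (a • x) h) = a • H.algebraic.toCompletion (H.gen k x h)
    rw [← smul_gen, PreCorr.toCompletion_smul], fun a x => by
    change H.algebraic.toCompletion (H.gen k (MulOpposite.op a • x) h)
      = MulOpposite.op a • H.algebraic.toCompletion (H.gen k x h)
    rw [← op_smul_gen, PreCorr.toCompletion_op_smul],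
    PreCorr.extend ((H.contract k h).mkContinuous ‖h‖ (H.norm_contract_le k h)), fun x y => by
    change H.algebraic.completion.ip (H.algebraic.toCompletion (H.gen k x h)) y = _
    refine H.algebraic.denseRange_toCompletion.induction_on
      (p := fun y => H.algebraic.completion.ip (H.algebraic.toCompletion (H.gen k x h)) y =
        k.rep.corr.ip x (PreCorr.extend ((H.contract k h).mkContinuous ‖h‖
          (H.norm_contract_le k h)) y)) y
      (isClosed_eq (PreCorr.continuous_ip_comp _ continuous_const continuous_id)
        (PreCorr.continuous_ip_comp _ continuous_const (ContinuousLinearMap.continuous _)))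
      fun v => ?_
    rw [PreCorr.ip_toCompletion, PreCorr.extend_toCompletion]
    exact ip_gen_left H k x h v⟩

theorem inclusion_apply (k : Irr A) (h : H k) (x : k.rep.corr) :
    (H.inclusion k h).toHom.1 x = H.algebraic.toCompletion (H.gen k x h) := rfl

/-- The amplification of a family of operators to the algebraic direct sum. -/
def amplify (S : ∀ k, H k →L[ℂ] H k) : H.algebraic →ₗ[ℂ] H.algebraic :=
  lift fun k => (H.gen k).compl₂ (S k).toLinearMap

theorem amplify_gen (S : ∀ k, H k →L[ℂ] H k) (k : Irr A) (x : k.rep.corr) (h : H k) :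
    H.amplify S (H.gen k x h) = H.gen k x (S k h) := lift_gen _ k x h

theorem amplify_smul (S : ∀ k, H k →L[ℂ] H k) (a : A) (v : H.algebraic) :
    H.amplify S (a • v) = a • H.amplify S v :=
  lift_smul (fun k => (H.gen k).compl₂ (S k).toLinearMap)
    (fun k a x _ => (H.smul_gen a k x _).symm) a v

theorem amplify_op_smul (S : ∀ k, H k →L[ℂ] H k) (a : A) (v : H.algebraic) :
    H.amplify S (MulOpposite.op a • v) = MulOpposite.op a • H.amplify S v :=
  lift_op_smul (fun k => (H.gen k).compl₂ (S k).toLinearMap)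
    (fun k a x _ => (H.op_smul_gen a k x _).symm) a v

theorem ip_amplify_left (S : ∀ k, H k →L[ℂ] H k) (v w : H.algebraic) :
    H.algebraic.ip (H.amplify S v) w = H.algebraic.ip v (H.amplify (fun k => star (S k)) w) := by
  induction v using gen_induction with
  | zero => simp [← PreCorr.ipₛₗ_apply]
  | add v v' hv hv' =>
    rw [PreCorr.ip_add_left, ← hv, ← hv', map_add, PreCorr.ip_add_left]
  | gen k x h =>
    induction w using gen_induction with
    | zero => simp [← PreCorr.ipₛₗ_apply]
    | add w w' hw hw' => rw [PreCorr.ip_add_right, hw, hw', map_add, PreCorr.ip_add_right]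
    | gen l y h' =>
      rw [amplify_gen, amplify_gen]
      by_cases hkl : k = l
      · subst hkl
        rw [ip_gen_gen, ip_gen_gen, ContinuousLinearMap.star_eq_adjoint,
          ContinuousLinearMap.adjoint_inner_right]
      · rw [ip_gen_gen_of_ne H hkl, ip_gen_gen_of_ne H hkl]

/-- Write `C² - S k* S k = R k* R k` in each `B(H k)`. Amplifying gives `⟨Rv, Rv⟩ + ⟨Sv, Sv⟩ = C²
⟨v, v⟩` in `A`, and the first term is positive. The bound thus holds for arbitrary vectors, not just
elementary tensors. -/
theorem norm_amplify_le (S : ∀ k, H k →L[ℂ] H k) {C : ℝ} (hC : 0 ≤ C) (hS : ∀ k, ‖S k‖ ≤ C)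
    (v : H.algebraic) : ‖H.amplify S v‖ ≤ C * ‖v‖ := by
  have h1 : ∀ k, ∃ R : H k →L[ℂ] H k,
      algebraMap ℝ (H k →L[ℂ] H k) (C ^ 2) - star (S k) * S k = star R * R := fun k => by
    refine CStarAlgebra.nonneg_iff_eq_star_mul_self.1 (sub_nonneg.2 ?_)
    refine CStarAlgebra.star_mul_le_algebraMap_norm_sq.trans ?_
    refine algebraMap_mono _ ?_
    gcongr
    exact hS k
  choose R hR using h1
  -- The operator identity `R* R + S* S = C²`, amplified and checked on generators.
  have h2 : ∀ w, H.amplify (fun k => star (R k)) (H.amplify R w) +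
      H.amplify (fun k => star (S k)) (H.amplify S w) = ((C ^ 2 : ℝ) : ℂ) • w := fun w => by
    induction w using gen_induction with
    | zero => simp
    | add w w' hw hw' => rw [smul_add, ← hw, ← hw']; simp only [map_add]; abel
    | gen k x h =>
      simp only [amplify_gen]
      rw [← map_add, ← map_smul]
      congr 1
      have := congrArg (fun T : H k →L[ℂ] H k => T h) (sub_eq_iff_eq_add.1 (hR k))
      refine this.symm.trans ?_
      rw [Algebra.algebraMap_eq_smul_one, Complex.coe_smul]; rfl
  have h3 : H.algebraic.ip (H.amplify S v) (H.amplify S v) ≤ (C ^ 2) • H.algebraic.ip v v := by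
    have h4 : H.algebraic.ip (H.amplify R v) (H.amplify R v) +
        H.algebraic.ip (H.amplify S v) (H.amplify S v) = (C ^ 2) • H.algebraic.ip v v := by
      rw [ip_amplify_left, ip_amplify_left, ← PreCorr.ip_add_right, h2, PreCorr.ip_smul_right,
        Complex.coe_smul]
    rw [← h4]
    exact le_add_of_nonneg_left (PreCorr.ip_self_nonneg _ _)
  have h5 := CStarAlgebra.norm_le_norm_of_nonneg_of_le (PreCorr.ip_self_nonneg _ _) h3
  rw [norm_smul, ← PreCorr.norm_sq, ← PreCorr.norm_sq, Real.norm_of_nonneg (by positivity),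
    ← mul_pow] at h5
  exact (pow_le_pow_iff_left₀ (norm_nonneg _) (by positivity) two_ne_zero).1 h5

/-- The endomorphism of the realization given by a bounded family of operators. -/
def amplifyEnd (S : ∀ k, H k →L[ℂ] H k) {C : ℝ} (hC : 0 ≤ C) (hS : ∀ k, ‖S k‖ ≤ C) :
    H.realization.endAlg :=
  let φ (S : ∀ k, H k →L[ℂ] H k) (hS : ∀ k, ‖S k‖ ≤ C) : H.algebraic →L[ℂ] H.realization :=
    H.algebraic.toCompletion ∘L (H.amplify S).mkContinuous C (H.norm_amplify_le S hC hS)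
  have hφ S hS v : φ S hS v = H.algebraic.toCompletion (H.amplify S v) := rfl
  -- The adjoint family obeys the same bound, so its amplification extends too and supplies the
  -- adjoint.
  have hS' k : ‖star (S k)‖ ≤ C := (norm_star (S k)).le.trans (hS k)
  ⟨(PreCorr.extend (φ S hS)).toLinearMap,
    PreCorr.extend_smul _ fun a x => by
      rw [hφ S hS, hφ S hS, amplify_smul, PreCorr.toCompletion_smul]; rfl,
    PreCorr.extend_op_smul _ fun a x => by
      rw [hφ S hS, hφ S hS, amplify_op_smul, PreCorr.toCompletion_op_smul]; rfl,
    PreCorr.extend (φ (fun k => star (S k)) hS'), fun x y => by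
      refine H.algebraic.denseRange_toCompletion.induction_on₂
        (p := fun x y => H.realization.ip (PreCorr.extend (φ S hS) x) y =
          H.realization.ip x (PreCorr.extend (φ (fun k => star (S k)) hS') y))
        (isClosed_eq (PreCorr.continuous_ip_comp _
            ((ContinuousLinearMap.continuous _).comp continuous_fst) continuous_snd)
          (PreCorr.continuous_ip_comp _ continuous_fst
            ((ContinuousLinearMap.continuous _).comp continuous_snd)))
        (fun a b => ?_) x y
      rw [PreCorr.extend_toCompletion, PreCorr.extend_toCompletion, hφ S hS, hφ _ hS']
      refine (PreCorr.ip_toCompletion _ _ _).trans ?_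
      refine Eq.trans ?_ (PreCorr.ip_toCompletion _ _ _).symm
      exact H.ip_amplify_left S a b⟩

theorem amplifyEnd_inclusion (S : ∀ k, H k →L[ℂ] H k) {C : ℝ} (hC : 0 ≤ C)
    (hS : ∀ k, ‖S k‖ ≤ C) (k : Irr A) (h : H k) (x : k.rep.corr) :
    (H.amplifyEnd S hC hS).1 ((H.inclusion k h).toHom.1 x) =
      (H.inclusion k (S k h)).toHom.1 x := by
  rw [inclusion_apply, inclusion_apply]
  refine (PreCorr.extend_toCompletion _ _).trans ?_
  exact congrArg H.algebraic.toCompletion (H.amplify_gen S k x h)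

end HilbObj

namespace Corr

/-! ### Density of the irreducible span and the evaluation unitary. -/

section irrSpan

variable (E : Corr.{u, v} A)

/-- The span of the ranges of all morphisms from irreducible objects to `E`. -/
def irrSpan : Submodule ℂ E :=
  Submodule.span ℂ {y | ∃ (k : Irr A) (f : HilbHom k.rep E) (x : k.rep.corr), f.toHom.1 x = y}

variable {E} in
theorem apply_mem_irrSpan {k : Irr A} (f : HilbHom k.rep E) (x : k.rep.corr) :
    f.toHom.1 x ∈ E.irrSpan :=
  Submodule.subset_span ⟨k, f, x, rfl⟩

/-- The evaluation pairing `(x, f) ↦ f x`. -/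
def evalPairing (K : IrrObj A) : K.corr →ₗ[ℂ] HilbHom K E →ₗ[ℂ] E :=
  LinearMap.mk₂ ℂ (fun x f => f.toHom.1 x) (fun _ _ f => map_add f.toHom.1 _ _)
    (fun _ _ f => map_smul f.toHom.1 _ _) (fun _ _ _ => rfl) (fun _ _ _ => rfl)

/-- The evaluation map `x ⊗ f ↦ f x`. -/
def eval : E.hilbObj.algebraic →ₗ[ℂ] E :=
  HilbObj.lift (H := E.hilbObj) fun k => E.evalPairing k.rep

theorem eval_gen (k : Irr A) (x : k.rep.corr) (f : E.hilbObj k) :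
    E.eval (E.hilbObj.gen k x f) = (HilbHom.toHom (K := k.rep) (E := E) f).1 x :=
  HilbObj.lift_gen (H := E.hilbObj) (fun k => E.evalPairing k.rep) k x f

/-- On generators with the same index this is the definition of the inner product on the Hom-space;
with different indices both sides vanish, the left one by Schur's lemma. -/
theorem ip_eval (v w : E.hilbObj.algebraic) :
    E.ip (E.eval v) (E.eval w) = E.hilbObj.algebraic.ip v w := by
  induction v using HilbObj.gen_induction with
  | zero => simp [← PreCorr.ipₛₗ_apply]
  | add v v' hv hv' => rw [PreCorr.ip_add_left, ← hv, ← hv', map_add, PreCorr.ip_add_left]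
  | gen k x f =>
    induction w using HilbObj.gen_induction with
    | zero => simp [← PreCorr.ipₛₗ_apply]
    | add w w' hw hw' => rw [PreCorr.ip_add_right, ← hw, ← hw', map_add, PreCorr.ip_add_right]
    | gen l y g =>
      rw [eval_gen, eval_gen]
      by_cases hkl : k = l
      · subst hkl
        rw [HilbObj.ip_gen_gen]
        exact HilbHom.ip_apply_apply (K := k.rep) (E := E) f g x y
      · rw [HilbObj.ip_gen_gen_of_ne _ hkl]
        exact HilbHom.ip_apply_apply_of_ne (E := E) hkl f g x y

variable {E}

theorem denseRange_eval (hd : Dense (E.irrSpan : Set E)) : DenseRange E.eval := by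
  refine hd.mono ?_
  rw [← LinearMap.coe_range, SetLike.coe_subset_coe]
  refine Submodule.span_le.2 ?_
  rintro _ ⟨k, f, x, rfl⟩
  exact ⟨E.hilbObj.gen k x f, E.eval_gen k x f⟩

/-- If the irreducible subobjects span a dense subspace, evaluation extends to a unitary. -/
theorem exists_unitary_of_dense (hd : Dense (E.irrSpan : Set E)) :
    ∃ U : E.hilbObj.realization ≃ₗ[ℂ] E, (∀ (a : A) x, U (a • x) = a • U x) ∧
      (∀ (a : A) x, U (MulOpposite.op a • x) = MulOpposite.op a • U x) ∧
      (∀ x y, E.ip (U x) (U y) = E.hilbObj.realization.ip x y) ∧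
      ∀ (k : Irr A) (x : k.rep.corr) (f : E.hilbObj k),
        U ((E.hilbObj.inclusion k f).toHom.1 x) =
          (HilbHom.toHom (K := k.rep) (E := E) f).1 x := by
  obtain ⟨U, h1, h2, h3, h4⟩ := PreCorr.unitarilyEquiv_of_denseRange E.eval
    (HilbObj.lift_smul (H := E.hilbObj) (fun k => E.evalPairing k.rep)
      fun k a x f => (HilbHom.toHom (K := k.rep) (E := E) f).2.1 a x)
    (HilbObj.lift_op_smul (H := E.hilbObj) (fun k => E.evalPairing k.rep)
      fun k a x f => (HilbHom.toHom (K := k.rep) (E := E) f).2.2.1 a x) E.ip_eval (denseRange_eval hd)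
  exact ⟨U, h1, h2, h3, fun k x f => (h4 _).trans (E.eval_gen k x f)⟩

theorem unitarilyEquiv_realization_of_dense (hd : Dense (E.irrSpan : Set E)) :
    E.UnitarilyEquiv E.hilbObj.realization := by
  obtain ⟨U, h1, h2, h3, -⟩ := exists_unitary_of_dense hd
  exact UnitarilyEquiv.symm ⟨U, h1, h2, h3⟩

/-- A continuous surjection maps dense sets to dense sets, and composing with `f` turns morphisms
into `E` into morphisms into `F`. -/
theorem dense_irrSpan_of_surjective {F : Corr.{u, w} A} (f : homSpace E F)
    (hf : Function.Surjective f.1) (hd : Dense (E.irrSpan : Set E)) :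
    Dense (F.irrSpan : Set F) := by
  refine (hf.denseRange.dense_image (continuous_hom f) hd).mono ?_
  rintro _ ⟨x, hx, rfl⟩
  refine Submodule.span_induction (p := fun x _ => f.1 x ∈ F.irrSpan) ?_ ?_ ?_ ?_ hx
  · rintro _ ⟨k, g, y, rfl⟩
    exact apply_mem_irrSpan (E := F) (comp f g.toHom) y
  · rw [map_zero]; exact zero_mem _
  · intro x y _ _ hx hy
    rw [map_add]; exact add_mem hx hy
  · intro c x _ hx
    rw [map_smul]; exact Submodule.smul_mem _ c hx

theorem dense_irrSpan_realization (H : HilbObj.{u, w} A) :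
    Dense (H.realization.irrSpan : Set H.realization) := by
  refine Dense.mono ?_ H.algebraic.denseRange_toCompletion
  rintro _ ⟨v, rfl⟩
  induction v using HilbObj.gen_induction with
  | zero => rw [map_zero]; exact zero_mem H.realization.irrSpan
  | add v w hv hw => rw [map_add]; exact add_mem (S := Submodule ℂ H.realization) hv hw
  | gen k x h => exact apply_mem_irrSpan (H.inclusion k h) x

/-- Since `H` is arbitrary here, combining this with `unitarilyEquiv_realization_of_dense` replaces
any realization of `E` by the canonical one, `|H_E|`. -/
theorem UnitarilyEquiv.dense_irrSpan {H : HilbObj.{u, w} A}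
    (h : E.UnitarilyEquiv H.realization) : Dense (E.irrSpan : Set E) := by
  obtain ⟨U, h1, h2, h3⟩ := h.symm
  exact dense_irrSpan_of_surjective (ofUnitary U h1 h2 h3) U.surjective
    (dense_irrSpan_realization H)

/-- A projection, as a morphism onto its range. -/
def rangeRestrict (Q : endAlg E) (hQ : IsStarProjection Q) : homSpace E (range Q hQ) :=
  ⟨LinearMap.rangeRestrict Q.1, fun a x => Subtype.ext (Q.2.1 a x),
    fun a x => Subtype.ext (Q.2.2.1 a x), Subtype.val (p := fun y => y ∈ LinearMap.range Q.1),
    fun x y => by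
      obtain ⟨_, z, rfl⟩ := y
      change E.ip (Q.1 x) (Q.1 z) = E.ip x (Q.1 z)
      have h1 : star Q = Q := hQ.isSelfAdjoint
      have h2 : Q.1 (Q.1 z) = Q.1 z := congrArg (fun R : endAlg E => R.1 z) hQ.isIdempotentElem
      rw [← ip_star_right, h1, h2]⟩

/-- The projection is a surjective morphism onto its range, so the range has dense irreducible span
and is realized by its own Hom-spaces. -/
theorem isHilb_range (hd : Dense (E.irrSpan : Set E)) (Q : endAlg E) (hQ : IsStarProjection Q) :
    (range Q hQ).IsHilb :=
  ⟨_, unitarilyEquiv_realization_of_dense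
    (dense_irrSpan_of_surjective (rangeRestrict Q hQ) (LinearMap.surjective_rangeRestrict _) hd)⟩

end irrSpan

/-! ### The representations of `End(E)` on the Hom-spaces. -/

section representation

variable {E : Corr.{u, v} A}

/-- An endomorphism as a bounded operator. -/
def endCLM (T : endAlg E) : E →L[ℂ] E := ⟨T.1, continuous_hom (endHom T)⟩

/-- Composition of a morphism from an irreducible object with an endomorphism. -/
def postcomp (T : endAlg E) {K : IrrObj A} (f : HilbHom K E) : HilbHom K E :=
  comp (endHom T) f.toHom

/-- A morphism from an irreducible object scales all norms by its Hilbert norm, so one nonzero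
vector suffices to compare. -/
theorem norm_postcomp_le (T : endAlg E) {K : IrrObj A} (f : HilbHom K E) :
    ‖postcomp T f‖ ≤ ‖endCLM T‖ * ‖f‖ := by
  have := K.irreducible.nontrivial
  obtain ⟨x, hx⟩ := exists_ne (0 : K.corr)
  refine le_of_mul_le_mul_right ?_ (norm_pos_iff.2 hx)
  calc _ = ‖endCLM T (f.toHom.1 x)‖ := (HilbHom.norm_apply _ x).symm
    _ ≤ ‖endCLM T‖ * ‖f.toHom.1 x‖ := ContinuousLinearMap.le_opNorm _ _
    _ = _ := by rw [HilbHom.norm_apply, mul_assoc]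

/-- The representation of `End_{A-A}(E)` on `Hom_{A-A}(K, E)` by composition, for `K` irreducible. -/
def homRep (E : Corr.{u, v} A) (K : IrrObj A) :
    endAlg E →⋆ₐ[ℂ] (HilbHom K E →L[ℂ] HilbHom K E) where
  toFun T := LinearMap.mkContinuous
    { toFun := postcomp T
      map_add' := fun f g => Subtype.ext (LinearMap.ext fun x => map_add T.1 _ _)
      map_smul' := fun c f => Subtype.ext (LinearMap.ext fun x => map_smul T.1 _ _) }
    ‖endCLM T‖ (norm_postcomp_le T)
  map_one' := rfl
  map_mul' _ _ := rfl
  map_zero' := rfl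
  map_add' _ _ := rfl
  commutes' _ := rfl
  map_star' T := by
    rw [ContinuousLinearMap.star_eq_adjoint, ContinuousLinearMap.eq_adjoint_iff]
    intro f g
    refine HilbHom.inner_eq fun x y => ?_
    rw [← HilbHom.ip_apply_apply]
    change E.ip ((star T).1 (f.toHom.1 x)) (g.toHom.1 y) = E.ip (f.toHom.1 x) (T.1 (g.toHom.1 y))
    rw [← ip_star_right, star_star]

theorem homRep_apply (T : endAlg E) (K : IrrObj A) (f : HilbHom K E) (x : K.corr) :
    (homRep E K T f).toHom.1 x = T.1 (f.toHom.1 x) := rfl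

theorem norm_homRep_le (T : endAlg E) (K : IrrObj A) : ‖homRep E K T‖ ≤ ‖endCLM T‖ :=
  LinearMap.mkContinuous_norm_le _ (norm_nonneg _) (norm_postcomp_le T)

/-- Joint faithfulness: the components determine an endomorphism on the span, and by continuity
everywhere. Algebraic identities in `End(E)` are proved below by comparing components. -/
theorem ext_homRep (hd : Dense (E.irrSpan : Set E)) {S T : endAlg E}
    (h : ∀ k : Irr A, homRep E k.rep S = homRep E k.rep T) : S = T := by
  refine Subtype.ext (LinearMap.ext fun x => ?_)
  refine congrFun (Continuous.ext_on hd (continuous_hom (endHom S)) (continuous_hom (endHom T))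
    fun y hy => LinearMap.eqOn_span ?_ hy) x
  rintro _ ⟨k, f, z, rfl⟩
  change S.1 _ = T.1 _
  rw [← homRep_apply, h, homRep_apply]

/-- Joint surjectivity onto bounded families: amplify `S` on `|H_E|` and conjugate by the evaluation
unitary, which sends `x ⊗ f` to `f x`. -/
theorem exists_homRep_eq (hd : Dense (E.irrSpan : Set E))
    (S : ∀ k : Irr A, HilbHom k.rep E →L[ℂ] HilbHom k.rep E) {C : ℝ} (hC : 0 ≤ C)
    (hS : ∀ k, ‖S k‖ ≤ C) : ∃ T : endAlg E, ∀ k : Irr A, homRep E k.rep T = S k := by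
  obtain ⟨U, h1, h2, h3, h4⟩ := exists_unitary_of_dense hd
  let u := ofUnitary U h1 h2 h3
  -- The adjoint of a unitary is its inverse, so `adj u` takes `f x` back to `x ⊗ f`.
  have hu : ∀ y, (adj u).1 (U y) = y := fun y => ext_ip fun x => by
    rw [ip_adj_right]; exact h3 x y
  let T := comp u (comp (endHom (E.hilbObj.amplifyEnd S hC hS)) (adj u))
  refine ⟨⟨T.1, T.2⟩, fun k => ?_⟩
  ext1 f
  refine Subtype.ext (LinearMap.ext fun x => ?_)
  change U ((E.hilbObj.amplifyEnd S hC hS).1 ((adj u).1 (f.toHom.1 x))) = (S k f).toHom.1 x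
  have h5 : (adj u).1 (f.toHom.1 x) = (E.hilbObj.inclusion k f).toHom.1 x :=
    (congrArg (adj u).1 (h4 k x f)).symm.trans (hu _)
  exact (congrArg (fun y => U ((E.hilbObj.amplifyEnd S hC hS).1 y)) h5).trans
    ((congrArg U (E.hilbObj.amplifyEnd_inclusion S hC hS k f x)).trans (h4 k x (S k f)))

/-- `End_{A-A}(E)` acts on `H_E` by bounded families of operators. -/
def toBoundedProd (E : Corr.{u, v} A) : endAlg E →⋆ₙₐ[ℂ] BoundedProd E.hilbObj where
  toFun T := (⟨fun k => homRep E k.rep T, memℓp_infty ⟨‖endCLM T‖, by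
    rintro _ ⟨k, rfl⟩
    exact norm_homRep_le T k.rep⟩⟩ : lp (fun k => E.hilbObj k →L[ℂ] E.hilbObj k) ∞)
  map_smul' c T := Subtype.ext (funext fun k => map_smul (homRep E k.rep) c T)
  map_zero' := Subtype.ext (funext fun k => map_zero (homRep E k.rep))
  map_add' S T := Subtype.ext (funext fun k => map_add (homRep E k.rep) S T)
  map_mul' S T := Subtype.ext (funext fun k => map_mul (homRep E k.rep) S T)
  map_star' T := Subtype.ext (funext fun k => map_star (homRep E k.rep) T)

theorem bijective_toBoundedProd (hd : Dense (E.irrSpan : Set E)) :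
    Function.Bijective (toBoundedProd E) := by
  refine ⟨fun S T h => ext_homRep hd fun k => ?_, fun b => ?_⟩
  · exact congrFun (congrArg Subtype.val h) k
  · let b' : lp (fun k => E.hilbObj k →L[ℂ] E.hilbObj k) ∞ := b
    obtain ⟨T, hT⟩ := exists_homRep_eq hd (fun k => b'.1 k) (norm_nonneg b')
      (lp.norm_apply_le_norm ENNReal.top_ne_zero b')
    exact ⟨T, Subtype.ext (funext hT)⟩

open Classical in
/-- The projections onto the isotypic components. -/
theorem exists_isotypic (hd : Dense (E.irrSpan : Set E)) : ∃ P : Irr A → endAlg E,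
    ∀ k l : Irr A, homRep E l.rep (P k) = if l = k then 1 else 0 := by
  refine Classical.axiom_of_choice fun k => exists_homRep_eq hd _ zero_le_one fun l => ?_
  split_ifs
  · exact ContinuousLinearMap.norm_id_le
  · rw [norm_zero]; exact zero_le_one

/-- The corner at an isotypic projection is the algebra of bounded operators on the Hom-space. -/
def cornerRep (P : endAlg E) (hP : IsStarProjection P) (K : IrrObj A) :
    corner P hP →⋆ₙₐ[ℂ] (HilbHom K E →L[ℂ] HilbHom K E) where
  toFun T := homRep E K T.1
  map_smul' c T := map_smul (homRep E K) c T.1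
  map_zero' := map_zero (homRep E K)
  map_add' S T := map_add (homRep E K) S.1 T.1
  map_mul' S T := map_mul (homRep E K) S.1 T.1
  map_star' T := map_star (homRep E K) T.1

open Classical in
theorem bijective_cornerRep (hd : Dense (E.irrSpan : Set E)) {P : endAlg E}
    (hP : IsStarProjection P) {k : Irr A}
    (h : ∀ l : Irr A, homRep E l.rep P = if l = k then 1 else 0) :
    Function.Bijective (cornerRep P hP k.rep) := by
  refine ⟨fun S T hST => Subtype.ext (ext_homRep hd fun l => ?_), fun R => ?_⟩
  · by_cases hl : l = k
    · subst hl; exact hST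
    -- Elements of the corner satisfy `P S = S`, and `P` acts by zero on all Hom-spaces except that
    -- of `k`.
    · rw [← S.2.1, ← T.2.1, map_mul, map_mul, h, if_neg hl, zero_mul, zero_mul]
  -- The preimage of `R` comes from the family with `R` at `k` and zero elsewhere, bounded by `‖R‖`.
  · obtain ⟨T, hT⟩ := exists_homRep_eq hd
      (fun l => Pi.single (M := fun l : Irr A => HilbHom l.rep E →L[ℂ] HilbHom l.rep E) k R l)
      (norm_nonneg R) fun l => by
        by_cases hl : l = k
        · subst hl; rw [Pi.single_eq_same]
        · rw [Pi.single_eq_of_ne hl, norm_zero]; exact norm_nonneg R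
    refine ⟨⟨T, ext_homRep hd fun l => ?_, ext_homRep hd fun l => ?_⟩, ?_⟩
    · by_cases hl : l = k
      · subst hl; rw [map_mul, h, if_pos rfl, one_mul]
      · rw [map_mul, h, if_neg hl, zero_mul, hT, Pi.single_eq_of_ne hl]
    · by_cases hl : l = k
      · subst hl; rw [map_mul, h, if_pos rfl, mul_one]
      · rw [map_mul, h, if_neg hl, mul_zero, hT, Pi.single_eq_of_ne hl]
    · exact (hT k).trans (Pi.single_eq_same (M := fun l : Irr A => HilbHom l.rep E →L[ℂ] HilbHom l.rep E) k R)

/-- Partial sums are projections, hence uniformly contractive, so convergence passes from a dense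
subspace to all of `E` by an `ε / 3` argument. -/
theorem hasSum_apply_of_dense {ι : Type*} (P : ι → endAlg E)
    (hP : ∀ s : Finset ι, IsStarProjection (∑ i ∈ s, P i)) {V : Submodule ℂ E}
    (hV : Dense (V : Set E)) (h : ∀ y ∈ V, HasSum (fun i => (P i).1 y) y) (x : E) :
    HasSum (fun i => (P i).1 x) x := by
  classical
  have hs : ∀ (s : Finset ι) (z : E), ∑ i ∈ s, (P i).1 z = (∑ i ∈ s, P i).1 z := fun s z => by
    rw [show (∑ i ∈ s, P i).1 = ∑ i ∈ s, (P i).1 from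
      map_sum (endAlg E).val P s, LinearMap.sum_apply]
  rw [HasSum, SummationFilter.unconditional_filter, Metric.tendsto_atTop]
  intro ε hε
  obtain ⟨y, hy, hxy⟩ := Metric.dense_iff.1 hV x (ε / 3) (by positivity)
  have h1 := h y hxy
  rw [HasSum, SummationFilter.unconditional_filter, Metric.tendsto_atTop] at h1
  obtain ⟨s₀, hs₀⟩ := h1 (ε / 3) (by positivity)
  refine ⟨s₀, fun s hss => ?_⟩
  have h2 := hs₀ s hss
  have hy' : dist x y < ε / 3 := by rw [dist_comm]; exact hy
  have h3 : dist (∑ i ∈ s, (P i).1 x) (∑ i ∈ s, (P i).1 y) ≤ dist x y := by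
    rw [hs, hs, dist_eq_norm, dist_eq_norm, ← map_sub]
    exact norm_projection_le (hP s) _
  calc _ ≤ dist (∑ i ∈ s, (P i).1 x) (∑ i ∈ s, (P i).1 y) + dist (∑ i ∈ s, (P i).1 y) y
        + dist y x := dist_triangle4 _ _ _ _
    _ < ε := by rw [dist_comm y x]; linarith

open Classical in
theorem hasSum_isotypic (hd : Dense (E.irrSpan : Set E)) {P : Irr A → endAlg E}
    (hP : ∀ k l : Irr A, homRep E l.rep (P k) = if l = k then 1 else 0) (x : E) :
    HasSum (fun k => (P k).1 x) x := by
  refine hasSum_apply_of_dense P (fun s => ?_) hd (fun y hy => ?_) x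
  -- Every component of a finite partial sum is `0` or `1`, so the sum is a projection.
  · have h1 : ∀ l, homRep E l.rep (∑ k ∈ s, P k) = if l ∈ s then 1 else 0 := fun l => by
      rw [map_sum, Finset.sum_congr rfl fun k _ => hP k l, Finset.sum_ite_eq]
    refine ⟨ext_homRep hd fun l => ?_, ext_homRep hd fun l => ?_⟩
    · rw [map_mul, h1]; split_ifs <;> simp
    · rw [map_star, h1]; split_ifs <;> simp
  · refine Submodule.span_induction (p := fun y _ => HasSum (fun k => (P k).1 y) y)
      ?_ ?_ ?_ ?_ hy
    · rintro _ ⟨l, f, z, rfl⟩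
      have h2 : (P l).1 (f.toHom.1 z) = f.toHom.1 z := by
        rw [← homRep_apply, hP, if_pos rfl]; rfl
      -- On the range of a morphism from `l`, only the term of index `l` is nonzero.
      have h3 := hasSum_single (f := fun k => (P k).1 (f.toHom.1 z)) l fun k hk => by
        rw [← homRep_apply, hP, if_neg (Ne.symm hk)]; rfl
      rwa [h2] at h3
    · simp only [map_zero]; exact hasSum_zero
    · intro y z _ _ h2 h3
      simp only [map_add]; exact h2.add h3
    · intro c y _ h2
      simp only [map_smul]; exact h2.const_smul c

open Classical in
theorem exists_isotypic_decomposition (hd : Dense (E.irrSpan : Set E)) :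
    ∃ (P : Irr A → endAlg E) (hP : ∀ k, IsStarProjection (P k)),
      (∀ k, P k ∈ Subalgebra.center ℂ E.endAlg) ∧
      Pairwise (fun k l => P k * P l = 0) ∧ StrictHasSum P 1 ∧
      ∀ k, Nonempty (corner (P k) (hP k) ≃⋆ₐ[ℂ] (E.hilbObj k →L[ℂ] E.hilbObj k)) := by
  obtain ⟨P, h⟩ := exists_isotypic hd
  have hP : ∀ k, IsStarProjection (P k) := fun k =>
    ⟨ext_homRep hd fun l => by rw [map_mul, h]; split_ifs <;> simp,
      ext_homRep hd fun l => by rw [map_star, h]; split_ifs <;> simp⟩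
  refine ⟨P, hP, fun k => ?_, fun k l hkl => ?_, ⟨fun x => ?_, fun x => ?_⟩, fun k => ?_⟩
  · refine Subalgebra.mem_center_iff.2 fun T => ext_homRep hd fun l => ?_
    rw [map_mul, map_mul, h]; split_ifs <;> simp
  · refine ext_homRep hd fun m => ?_
    rw [map_mul, map_zero, h, h]
    split_ifs with h1 h2
    · exact absurd (h1.symm.trans h2) hkl
    all_goals simp
  · exact hasSum_isotypic hd h x
  · simp_rw [fun k => (hP k).isSelfAdjoint.star_eq, star_one]
    exact hasSum_isotypic hd h x
  · exact ⟨StarAlgEquiv.ofBijective _ (bijective_cornerRep hd (hP k) (h k))⟩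

end representation

end Corr

end

end CStarCorr

/-! ### The equivalence and the structure of the endomorphism algebra. -/

theorem theoremC {A : Type u} {D : Type v} [CStarAlgebra A] [PartialOrder A] [StarOrderedRing A]
    [Nontrivial A] [CStarAlgebra D] [PartialOrder D] [StarOrderedRing D]
    (hA : Subalgebra.center ℂ A = ⊥) (S : CStarCorr.FaithfulInclusion A D) :
    (S.IsIndInclusion ↔
      ∃ (ι : Type (max (u + 1) v)) (P : ι → S.hilb.endAlg) (hP : ∀ i, IsStarProjection (P i)),
        (∀ i, P i ∈ Subalgebra.center ℂ S.hilb.endAlg) ∧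
        Pairwise (fun i j => P i * P j = 0) ∧
        CStarCorr.Corr.StrictHasSum P 1 ∧
        (∀ i, ∃ H : CStarCorr.HilbertSpace.{max u v},
          Nonempty (CStarCorr.Corr.corner (P i) (hP i) ≃⋆ₐ[ℂ] (H →L[ℂ] H))) ∧
        ∀ (Q : S.hilb.endAlg) (hQ : IsStarProjection Q), (CStarCorr.Corr.range Q hQ).IsHilb) ∧
    (S.IsIndInclusion →
      Nonempty (S.hilb.endAlg ≃⋆ₐ[ℂ] CStarCorr.BoundedProd S.hilb.hilbObj)) := by
  refine ⟨⟨fun h => ?_, ?_⟩, fun h => ?_⟩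
  · have hd := h.dense_irrSpan
    obtain ⟨P, hP, h1, h2, h3, h4⟩ := CStarCorr.Corr.exists_isotypic_decomposition hd
    -- The index set is all of `Irr A`, lifted to the required universe; classes absent from `ℰ`
    -- contribute the zero projection and the zero Hilbert space.
    exact ⟨ULift.{v} (CStarCorr.Irr A), fun i => P i.down, fun i => hP i.down,
      fun i => h1 i.down, fun i j hij => h2 fun h => hij (ULift.ext _ _ h),
      ⟨fun x => (Equiv.ulift.hasSum_iff (f := fun k => (P k).1 x)).2 (h3.1 x),
        fun x => (Equiv.ulift.hasSum_iff (f := fun k => (star (P k)).1 x)).2 (h3.2 x)⟩,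
      fun i => ⟨S.hilb.hilbObj i.down, h4 i.down⟩, CStarCorr.Corr.isHilb_range hd⟩
  · rintro ⟨-, -, -, -, -, -, -, h⟩
    -- The range of the projection `1` is `ℰ` itself, so `ℰ` is some `|H|`, and density lets `H_ℰ`
    -- replace `H`.
    obtain ⟨H, hH⟩ := h 1 (.one _)
    exact CStarCorr.Corr.unitarilyEquiv_realization_of_dense
      ((CStarCorr.Corr.unitarilyEquiv_range_one (.one _)).symm.trans hH).dense_irrSpan
  · exact ⟨StarAlgEquiv.ofBijective _ (CStarCorr.Corr.bijective_toBoundedProd h.dense_irrSpan)⟩
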